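/- Let $E$ be a locally compact Hausdorff space with a countable base, equipped with its Borel $\sigma$-algebra, and let $\Omega$ be the space of continuous trajectories $\omega:[0,\infty)\to E$, with the compact-open topology and the $\sigma$-algebra generated by the coordinate maps $X_t(\omega)=\omega(t)$, $t\ge 0$. Consider a diffusion on $E$, i.e. the following data. $(\hat P_t)_{t\ge0}$ is a strongly continuous semigroup of bounded linear operators on $C_0(E)$ with $\hat P_0=I$ such that $0\le f\le 1$ implies $0\le \hat P_tf\le1$; it is honest, i.e. the kernels $P_t(x,\mathrm dy)$ determined by $\hat P_tf(x)=\int f(y)\,P_t(x,\mathrm dy)$ for $f\in C_0(E)$ are Markov kernels (of total mass one). For every $x\in E$, $\mathbb P^x$ is a probability measure on $\Omega$ with $\mathbb P^x(X_0\in \mathrm dx_0,X_{t_1}\in \mathrm dx_1,\dots,X_{t_n}\in \mathrm dx_n)=\delta_x(\mathrm dx_0)P_{t_1}(x_0,\mathrm dx_1)\cdots P_{t_n-t_{n-1}}(x_{n-1},\mathrm dx_n)$ for all $n$ and $0<t_1<\dots<t_n$; and $\mathbb P^{x_n}\to\mathbb P^x$ weakly whenever $x_n\to x$ in $E$. Let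 $obs:E\to[0,1]$ be continuous and let $0<c<1$. For probability measures $\mu,\nu$ on the same space and a cost $k$ with values in $[0,1]$, put $W(k)(\mu,\nu)=\inf_\gamma\int k\,\mathrm d\gamma$, where $\gamma$ ranges over the couplings of $\mu$ and $\nu$. For $m:E\times E\to[0,1]$ put $$\mathcal F_c(m)(x,y)=\sup_{t\ge0}c^t\,W(m)(P_t(x,\cdot),P_t(y,\cdot)),\qquad U_c(m)(\omega,\omega')=\sup_{t\ge0}c^t\,m(\omega(t),\omega'(t)),\qquad \mathcal G_c(m)(x,y)=W(U_c(m))(\mathbb P^x,\mathbb P^y).$$ Set $\delta^c_0(x,y)=d^c_0(x,y)=|obs(x)-obs(y)|$ and, for $n\ge0$, $\delta^c_{n+1}=\mathcal F_c(\delta^c_n)$ and $d^c_{n+1}=\mathcal G_c(d^c_n)$. Let $\overline\delta^c=\sup_n\delta^c_n$ (the kernel-based pseudometric) and $\overline d^c=\sup_n d^c_n$ (the trajectory-based pseudometric). Let $\Lambda$ be the set of expressions $$f::=q\mid obs\mid\min\{f_1,f_2\}\mid 1-f\mid f\ominus q\mid\langle t\rangle f,$$ and let $\mathcal L_\sigma$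 and $\mathcal L_\tau$ be the sets of expressions generated by the mutual recursion $$f\in\mathcal L_\sigma::=q\mid obs\mid 1-f\mid\textstyle\int g,\qquad g\in\mathcal L_\tau::=f\circ ev_t\mid\min\{g_1,g_2\}\mid\max\{g_1,g_2\}\mid g\ominus q\mid g\oplus q,$$ with $q\in\mathbb Q\cap[0,1]$ and $t\in\mathbb Q_{\ge0}$. The expressions of $\Lambda$ and $\mathcal L_\sigma$ are interpreted as functions on $E$, those of $\mathcal L_\tau$ as functions on $\Omega$: constants, $obs$, $1-f$, $\min$ and $\max$ have their usual (pointwise) meaning, $f\ominus q=\max\{0,f-q\}$, $g\oplus q=\min\{1,g+q\}$, $(\langle t\rangle f)(x)=c^t\int f(y)\,P_t(x,\mathrm dy)$, $(\int g)(x)=\int g\,\mathrm d\mathbb P^x$ and $(f\circ ev_t)(\omega)=c^tf(\omega(t))$. Put $$\lambda^c(x,y)=\sup_{f\in\Lambda}|f(x)-f(y)|,\qquad \ell^c(x,y)=\sup_{f\in\mathcal L_\sigma}|f(x)-f(y)|.$$ Theorem. For every $0<c<1$, $$\lambda^c=\overline\delta^c\le\overline d^c=\ell^c$$ as functions on $E\times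 E$. -/

import Mathlib

open MeasureTheory ProbabilityTheory Filter Topology
open scoped NNReal ENNReal ZeroAtInfty BoundedContinuousFunction

namespace FellerDynkin

/-! ### Optimal transport -/

section Transport

variable {X : Type*} [MeasurableSpace X]

/-- The set `Γ(μ, ν)` of couplings of `μ` and `ν`. -/
def couplings (μ ν : Measure X) : Set (Measure (X × X)) :=
  {γ | IsProbabilityMeasure γ ∧ γ.map Prod.fst = μ ∧ γ.map Prod.snd = ν}

/-- The optimal transport cost `W(k)(μ, ν) = inf_{γ ∈ Γ(μ, ν)} ∫ k dγ` for a cost function `k`.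
Costs and pseudometrics are functions with values in `[0, ∞]` throughout; those that occur below
take their values in `[0, 1]`. -/
noncomputable def transport (k : X → X → ℝ≥0∞) (μ ν : Measure X) : ℝ≥0∞ :=
  ⨅ γ ∈ couplings μ ν, ∫⁻ p, k p.1 p.2 ∂γ

end Transport

/-! ### Feller-Dynkin semigroups and diffusions -/

/-- A Feller-Dynkin semigroup on `C₀(E)`. -/
structure FDSemigroup (E : Type*) [TopologicalSpace E] where
  op : ℝ≥0 → C₀(E, ℝ) →L[ℝ] C₀(E, ℝ)
  op_comp : ∀ s t, (op s).comp (op t) = op (s + t)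
  op_zero : op 0 = ContinuousLinearMap.id ℝ C₀(E, ℝ)
  strongly_continuous : ∀ f : C₀(E, ℝ), Tendsto (fun t => ‖op t f - f‖) (𝓝[>] 0) (𝓝 0)
  sub_markov : ∀ (t : ℝ≥0) (f : C₀(E, ℝ)), (∀ x, 0 ≤ f x ∧ f x ≤ 1) →
    ∀ x, 0 ≤ op t f x ∧ op t f x ≤ 1

/-- The space `Ω` of continuous trajectories `[0, ∞) → E`. Its topology is the compact-open
topology (uniform convergence on compact time intervals). -/
abbrev Trajectory (E : Type*) [TopologicalSpace E] := C(ℝ≥0, E)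

/-- The `σ`-algebra `𝒜 = σ(X_s | s ≥ 0)` generated by the coordinates `X_s(ω) = ω(s)`. -/
instance Trajectory.instMeasurableSpace (E : Type*) [TopologicalSpace E] [MeasurableSpace E] :
    MeasurableSpace (Trajectory E) :=
  ⨆ s : ℝ≥0, MeasurableSpace.comap (fun ω : Trajectory E => ω s) inferInstance

section CylinderLaw

variable {E : Type*} [TopologicalSpace E] [MeasurableSpace E]

/-- For a list `(t₁, C₁), …, (tₙ, Cₙ)` with `s < t₁ < ⋯ < tₙ`, the iterated integral
`∫_{C₁} P_{t₁ - s}(x, dx₁) ∫_{C₂} P_{t₂ - t₁}(x₁, dx₂) ⋯ ∫_{Cₙ} P_{tₙ - tₙ₋₁}(xₙ₋₁, dxₙ)`. -/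
noncomputable def cylinderProb (P : ℝ≥0 → Kernel E E) : ℝ≥0 → List (ℝ≥0 × Set E) → E → ℝ≥0∞
  | _, [], _ => 1
  | s, (t, C) :: l, x => ∫⁻ y in C, cylinderProb P t l y ∂(P (t - s) x)

end CylinderLaw

/-- A diffusion: an honest Feller-Dynkin semigroup `(P̂_t)` together with the (unique) Markov
kernels `(P_t)` that represent it and the (unique) laws `ℙ^x` of the associated canonical process,
which live on the continuous trajectories and depend weakly continuously on `x`. -/
structure Diffusion (E : Type*) [TopologicalSpace E] [MeasurableSpace E]
    extends FDSemigroup E where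
  kernel : ℝ≥0 → Kernel E E
  /-- honesty: no loss of mass -/
  honest : ∀ t, IsMarkovKernel (kernel t)
  op_eq_integral : ∀ (t : ℝ≥0) (f : C₀(E, ℝ)) (x : E), op t f x = ∫ y, f y ∂(kernel t x)
  law : E → Measure (Trajectory E)
  law_prob : ∀ x, IsProbabilityMeasure (law x)
  /-- finite dimensional distributions, at the times `0 < t₁ < ⋯ < tₙ` -/
  law_cylinder : ∀ (x : E) (A : Set E) (l : List (ℝ≥0 × Set E)),
    MeasurableSet A → (∀ p ∈ l, MeasurableSet p.2) →
    (0 :: l.map Prod.fst).Pairwise (· < ·) →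
    law x {ω | ω 0 ∈ A ∧ ∀ p ∈ l, ω p.1 ∈ p.2} =
      ∫⁻ x₀ in A, cylinderProb kernel 0 l x₀ ∂(Measure.dirac x)
  /-- weak continuity of `x ↦ ℙ^x` -/
  law_continuous : ∀ (u : ℕ → E) (x : E), Tendsto u atTop (𝓝 x) → ∀ f : Trajectory E →ᵇ ℝ,
    Tendsto (fun n => ∫ ω, f ω ∂(law (u n))) atTop (𝓝 (∫ ω, f ω ∂(law x)))

/-! ### The two functionals and their iterates -/

section Pseudometrics

variable {E : Type*} [TopologicalSpace E] [MeasurableSpace E]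

/-- The pseudometric `(x, y) ↦ |obs(x) - obs(y)|`. -/
noncomputable def obsDist (obs : C(E, unitInterval)) (x y : E) : ℝ≥0∞ :=
  ENNReal.ofReal |(obs x : ℝ) - obs y|

/-- `𝓕_c(m)(x, y) = sup_{t ≥ 0} c^t W(m)(P_t(x), P_t(y))`. -/
noncomputable def kernelFunctional (D : Diffusion E) (c : ℝ) (m : E → E → ℝ≥0∞) (x y : E) : ℝ≥0∞ :=
  ⨆ t : ℝ≥0, ENNReal.ofReal (c ^ (t : ℝ)) * transport m (D.kernel t x) (D.kernel t y)

/-- The sequence `δ^c_0 = |obs - obs|`, `δ^c_{n+1} = 𝓕_c(δ^c_n)`. -/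
noncomputable def deltaSeq (D : Diffusion E) (obs : C(E, unitInterval)) (c : ℝ) :
    ℕ → E → E → ℝ≥0∞
  | 0 => obsDist obs
  | n + 1 => kernelFunctional D c (deltaSeq D obs c n)

/-- The kernel-based pseudometric `δ̄^c = sup_n δ^c_n`. -/
noncomputable def deltaBar (D : Diffusion E) (obs : C(E, unitInterval)) (c : ℝ) (x y : E) : ℝ≥0∞ :=
  ⨆ n, deltaSeq D obs c n x y

/-- The discounted uniform pseudometric `U_c(m)(ω, ω') = sup_{t ≥ 0} c^t m(ω(t), ω'(t))`. -/
noncomputable def discountedUniform (c : ℝ) (m : E → E → ℝ≥0∞) (ω ω' : Trajectory E) : ℝ≥0∞ :=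
  ⨆ t : ℝ≥0, ENNReal.ofReal (c ^ (t : ℝ)) * m (ω t) (ω' t)

/-- `𝓖_c(m)(x, y) = W(U_c(m))(ℙ^x, ℙ^y)`. -/
noncomputable def trajFunctional (D : Diffusion E) (c : ℝ) (m : E → E → ℝ≥0∞) (x y : E) : ℝ≥0∞ :=
  transport (discountedUniform c m) (D.law x) (D.law y)

/-- The sequence `d^c_0 = |obs - obs|`, `d^c_{n+1} = 𝓖_c(d^c_n)`. -/
noncomputable def dSeq (D : Diffusion E) (obs : C(E, unitInterval)) (c : ℝ) : ℕ → E → E → ℝ≥0∞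
  | 0 => obsDist obs
  | n + 1 => trajFunctional D c (dSeq D obs c n)

/-- The trajectory-based pseudometric `d̄^c = sup_n d^c_n`. -/
noncomputable def dBar (D : Diffusion E) (obs : C(E, unitInterval)) (c : ℝ) (x y : E) : ℝ≥0∞ :=
  ⨆ n, dSeq D obs c n x y

end Pseudometrics

/-! ### The two real-valued logics -/

/-- The expressions of the logic `Λ`. -/
inductive KernelFormula : Type
  | const (q : Set.Icc (0 : ℚ) 1)
  | obs
  | min (f₁ f₂ : KernelFormula)
  | compl (f : KernelFormula)
  | tsub (f : KernelFormula) (q : Set.Icc (0 : ℚ) 1)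
  | diamond (t : ℚ≥0) (f : KernelFormula)

mutual

/-- The expressions of the logic `𝓛_σ`. -/
inductive StateFormula : Type
  | const (q : Set.Icc (0 : ℚ) 1)
  | obs
  | compl (f : StateFormula)
  | integral (g : TrajFormula)

/-- The expressions of the logic `𝓛_τ`. -/
inductive TrajFormula : Type
  | ev (f : StateFormula) (t : ℚ≥0)
  | min (g₁ g₂ : TrajFormula)
  | max (g₁ g₂ : TrajFormula)
  | tsub (g : TrajFormula) (q : Set.Icc (0 : ℚ) 1)
  | tadd (g : TrajFormula) (q : Set.Icc (0 : ℚ) 1)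

end

section Logics

variable {E : Type*} [TopologicalSpace E] [MeasurableSpace E]

/-- The interpretation of the expressions of `Λ` as functions on the state space. -/
noncomputable def KernelFormula.eval (D : Diffusion E) (o : C(E, unitInterval)) (c : ℝ) :
    KernelFormula → E → ℝ
  | .const q, _ => ((q : ℚ) : ℝ)
  | .obs, x => o x
  | .min f₁ f₂, x => Min.min (f₁.eval D o c x) (f₂.eval D o c x)
  | .compl f, x => 1 - f.eval D o c x
  | .tsub f q, x => Max.max 0 (f.eval D o c x - ((q : ℚ) : ℝ))
  | .diamond t f, x => c ^ (t : ℝ) * ∫ y, f.eval D o c y ∂(D.kernel (t : ℝ≥0) x)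

mutual

/-- The interpretation of the expressions of `𝓛_σ` as functions on the state space. -/
noncomputable def StateFormula.eval (D : Diffusion E) (o : C(E, unitInterval)) (c : ℝ) :
    StateFormula → E → ℝ
  | .const q, _ => ((q : ℚ) : ℝ)
  | .obs, x => o x
  | .compl f, x => 1 - f.eval D o c x
  | .integral g, x => ∫ ω, g.eval D o c ω ∂(D.law x)

/-- The interpretation of the expressions of `𝓛_τ` as functions on the trajectory space. -/
noncomputable def TrajFormula.eval (D : Diffusion E) (o : C(E, unitInterval)) (c : ℝ) :
    TrajFormula → Trajectory E → ℝ
  | .ev f t, ω => c ^ (t : ℝ) * f.eval D o c (ω (t : ℝ≥0))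
  | .min g₁ g₂, ω => Min.min (g₁.eval D o c ω) (g₂.eval D o c ω)
  | .max g₁ g₂, ω => Max.max (g₁.eval D o c ω) (g₂.eval D o c ω)
  | .tsub g q, ω => Max.max 0 (g.eval D o c ω - ((q : ℚ) : ℝ))
  | .tadd g q, ω => Min.min 1 (g.eval D o c ω + ((q : ℚ) : ℝ))

end

/-- The logical pseudometric `λ^c(x, y) = sup_{f ∈ Λ_c} |f(x) - f(y)|`. -/
noncomputable def lambdaDist (D : Diffusion E) (obs : C(E, unitInterval)) (c : ℝ) (x y : E) :
    ℝ≥0∞ :=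
  ⨆ f : KernelFormula, ENNReal.ofReal |f.eval D obs c x - f.eval D obs c y|

/-- The logical pseudometric `ℓ^c(x, y) = sup_{f ∈ 𝓛_σ^c} |f(x) - f(y)|`. -/
noncomputable def ellDist (D : Diffusion E) (obs : C(E, unitInterval)) (c : ℝ) (x y : E) :
    ℝ≥0∞ :=
  ⨆ f : StateFormula, ENNReal.ofReal |f.eval D obs c x - f.eval D obs c y|

end Logics

end FellerDynkin

open FellerDynkin

namespace FellerDynkin

-- The logical pseudometrics lie below the iterated ones because every connective is 1-Lipschitz and
-- two integrals of a function differ by at most the transport cost of any `k` that dominates its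
-- oscillation (`ofReal_abs_integral_sub_le_transport`). By induction each formula is controlled by
-- a finite iterate, and only `diamond` and `integral` raise the level.
--
-- Conversely, `lambdaDist` and `ellDist` dominate the initial pseudometric and are prefixed points
-- of the monotone functionals 𝓕_c and 𝓖_c, so they dominate all iterates. The prefixed point
-- property is Kantorovich duality (`IsApproxLattice.transport_le`): for a countable family of
-- measurable functions gᵢ whose uniform closure is stable under the lattice operations, the
-- transport cost of sup |gᵢ(x) - gᵢ(y)| is at most sup |∫ gᵢ dμ - ∫ gᵢ dν|. It is applied to Λ on E
-- and to 𝓛_τ on Ω, where the integrals (discounted, for Λ) are again formulas; continuity in time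
-- reduces real times to rational ones.
--
-- For the duality, a Stone-Weierstrass type argument shows that a [0, 1]-valued function which is
-- Lipschitz for finitely many gᵢ is a uniform limit of members of the family, so testing the family
-- bounds all dual potentials. The M. Riesz extension theorem and Riesz-Markov then give an optimal
-- measure on the square of a compact space into which X embeds measurably; since X is standard
-- Borel, the measure pulls back to a coupling.
--
-- The middle inequality holds because evaluation at time t sends couplings of path laws to
-- couplings of transition kernels.

theorem exists_rat_mem_Icc_abs_sub_le {a ε : ℝ} (ha : a ∈ Set.Icc (0 : ℝ) 1) (hε : 0 < ε) :
    ∃ q : Set.Icc (0 : ℚ) 1, |((q : ℚ) : ℝ) - a| ≤ ε := by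
  rcases eq_or_lt_of_le ha.2 with h1 | h1
  · exact ⟨⟨1, by simp⟩, by simp [h1, hε.le]⟩
  · obtain ⟨q, hq1, hq2⟩ := exists_rat_btwn (lt_min h1 (by linarith : a < a + ε))
    refine ⟨⟨q, ?_, ?_⟩, ?_⟩
    · exact_mod_cast ha.1.trans hq1.le
    · exact_mod_cast (hq2.trans_le (min_le_left _ _)).le
    · rw [abs_of_pos (by simpa using hq1)]
      simp only
      linarith [hq2.trans_le (min_le_right _ _)]

-- Stone-Weierstrass for lattices of [0, 1]-valued functions

section UniformClosure

variable {X ι : Type*}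

/-- The uniform closure of a family of real functions. -/
def uniformClosure (g : ι → X → ℝ) : Set (X → ℝ) :=
  {h | ∀ ε > 0, ∃ i, ∀ x, |g i x - h x| ≤ ε}

theorem mem_uniformClosure_self (g : ι → X → ℝ) (i : ι) : g i ∈ uniformClosure g :=
  fun ε hε => ⟨i, fun x => by simpa using hε.le⟩

theorem mem_uniformClosure_of_approx {g : ι → X → ℝ} {h : X → ℝ}
    (hh : ∀ ε > 0, ∃ k ∈ uniformClosure g, ∀ x, |k x - h x| ≤ ε) : h ∈ uniformClosure g := by
  intro ε hε
  obtain ⟨k, hk, hkh⟩ := hh (ε / 2) (by positivity)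
  obtain ⟨i, hi⟩ := hk (ε / 2) (by positivity)
  refine ⟨i, fun x => ?_⟩
  have := abs_sub_le (g i x) (k x) (h x)
  linarith [hi x, hkh x]

/-- A family of `[0, 1]`-valued functions whose uniform closure is stable under minima, under
`f ↦ 1 - f` and under truncated subtraction of rational constants. -/
structure IsApproxLattice (g : ι → X → ℝ) : Prop where
  mem_Icc : ∀ i x, g i x ∈ Set.Icc (0 : ℝ) 1
  inf_mem : ∀ i j, (fun x => min (g i x) (g j x)) ∈ uniformClosure g
  compl_mem : ∀ i, (fun x => 1 - g i x) ∈ uniformClosure g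
  tsub_mem : ∀ i (q : Set.Icc (0 : ℚ) 1),
    (fun x => max 0 (g i x - ((q : ℚ) : ℝ))) ∈ uniformClosure g

/-- The pseudometric `sup_{i ∈ S} |gᵢ(x) - gᵢ(y)|`. -/
noncomputable def finDist (g : ι → X → ℝ) (S : Finset ι) (x y : X) : ℝ :=
  dist (fun i : S => g i x) (fun i : S => g i y)

theorem finDist_le_iff {g : ι → X → ℝ} {S : Finset ι} {x y : X} {d : ℝ}
    (hd : 0 ≤ d) : finDist g S x y ≤ d ↔ ∀ i ∈ S, |g i x - g i y| ≤ d := by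
  simp [finDist, dist_pi_le_iff hd, Real.dist_eq]

namespace IsApproxLattice

variable {g : ι → X → ℝ}

theorem mem_Icc_of_mem (H : IsApproxLattice g) {h : X → ℝ} (hh : h ∈ uniformClosure g) (x : X) :
    h x ∈ Set.Icc (0 : ℝ) 1 := by
  constructor <;> refine le_of_forall_pos_le_add fun ε hε => ?_ <;>
    obtain ⟨i, hi⟩ := hh ε hε <;> have := abs_le.1 (hi x) <;> have := H.mem_Icc i x <;>
    rw [Set.mem_Icc] at this <;> linarith

theorem compl (H : IsApproxLattice g) {h : X → ℝ} (hh : h ∈ uniformClosure g) :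
    (fun x => 1 - h x) ∈ uniformClosure g := by
  refine mem_uniformClosure_of_approx fun ε hε => ?_
  obtain ⟨i, hi⟩ := hh ε hε
  refine ⟨_, H.compl_mem i, fun x => ?_⟩
  rw [show 1 - g i x - (1 - h x) = -(g i x - h x) by ring, abs_neg]
  exact hi x

theorem inf (H : IsApproxLattice g) {h k : X → ℝ} (hh : h ∈ uniformClosure g)
    (hk : k ∈ uniformClosure g) : (fun x => min (h x) (k x)) ∈ uniformClosure g := by
  refine mem_uniformClosure_of_approx fun ε hε => ?_
  obtain ⟨i, hi⟩ := hh ε hε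
  obtain ⟨j, hj⟩ := hk ε hε
  exact ⟨_, H.inf_mem i j, fun x =>
    (abs_min_sub_min_le_max _ _ _ _).trans (max_le (hi x) (hj x))⟩

theorem sup (H : IsApproxLattice g) {h k : X → ℝ} (hh : h ∈ uniformClosure g)
    (hk : k ∈ uniformClosure g) : (fun x => max (h x) (k x)) ∈ uniformClosure g := by
  convert H.compl (H.inf (H.compl hh) (H.compl hk)) using 2 with x
  grind

theorem tsub (H : IsApproxLattice g) {h : X → ℝ} (hh : h ∈ uniformClosure g) {a : ℝ}
    (ha : a ∈ Set.Icc (0 : ℝ) 1) : (fun x => max 0 (h x - a)) ∈ uniformClosure g := by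
  refine mem_uniformClosure_of_approx fun ε hε => ?_
  obtain ⟨i, hi⟩ := hh (ε / 2) (by positivity)
  obtain ⟨q, hqa⟩ := exists_rat_mem_Icc_abs_sub_le ha (half_pos hε)
  refine ⟨_, H.tsub_mem i q, fun x => ?_⟩
  refine (abs_max_sub_max_le_max _ _ _ _).trans (max_le (by simpa using hε.le) ?_)
  have h1 := abs_le.1 (hi x)
  have h2 := abs_le.1 hqa
  rw [abs_le]
  constructor <;> linarith

/-- A downward shift is a truncated subtraction; an upward shift is one conjugated by h ↦ 1 - h. -/
theorem shift (H : IsApproxLattice g) {h : X → ℝ} (hh : h ∈ uniformClosure g) {a : ℝ}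
    (ha : |a| ≤ 1) : (fun x => max 0 (min 1 (h x + a))) ∈ uniformClosure g := by
  have ha' := abs_le.1 ha
  have hI := H.mem_Icc_of_mem hh
  simp only [Set.mem_Icc] at hI
  rcases le_total a 0 with h0 | h0
  · convert H.tsub hh (a := -a) ⟨by linarith, by linarith⟩ using 2 with x
    have := hI x
    grind
  · convert H.compl (H.tsub (H.compl hh) (a := a) ⟨by linarith, by linarith⟩) using 2 with x
    have := hI x
    grind

theorem const_mem (H : IsApproxLattice g) [Nonempty ι] {r : ℝ} (hr : r ∈ Set.Icc (0 : ℝ) 1) :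
    (fun _ : X => r) ∈ uniformClosure g := by
  obtain ⟨i⟩ := ‹Nonempty ι›
  -- Shifting up by 1 saturates at the constant 1, which is then lowered to r.
  have h1 := H.shift (mem_uniformClosure_self g i) (a := 1) (by simp)
  have h2 := H.shift h1 (a := r - 1) (by rw [abs_le]; constructor <;> linarith [hr.1, hr.2])
  convert h2 using 2 with x
  have := H.mem_Icc i x
  rw [Set.mem_Icc] at this hr
  grind

/-- The truncated cones `y ↦ r - sup_{i ∈ S} |gᵢ(x) - gᵢ(y)|` belong to the uniform closure. -/
theorem exists_cone (H : IsApproxLattice g) [Nonempty ι] (x : X) {r : ℝ}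
    (hr : r ∈ Set.Icc (0 : ℝ) 1) (S : Finset ι) :
    ∃ k ∈ uniformClosure g, (∀ y, k y ≤ r) ∧
      (∀ y, ∀ i ∈ S, k y ≤ max 0 (r - |g i x - g i y|)) ∧
      ∀ y d, 0 ≤ d → (∀ i ∈ S, |g i x - g i y| ≤ d) → r - d ≤ k y := by
  classical
  induction S using Finset.induction_on with
  | empty => exact ⟨_, H.const_mem hr, by simp, by simp, fun y d hd _ => by linarith⟩
  | insert i S hi ih =>
    obtain ⟨k, hk, hkr, hkS, hkd⟩ := ih
    have hx := H.mem_Icc i x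
    have hy := H.mem_Icc i
    simp only [Set.mem_Icc] at hx hr hy
    -- The two sides of the cone, r + (gᵢ(y) - gᵢ(x)) and r - (gᵢ(y) - gᵢ(x)), truncated to [0, 1];
    -- their minimum is the truncation of r - |gᵢ(x) - gᵢ(y)|.
    have h1 := H.shift (mem_uniformClosure_self g i) (a := r - g i x)
      (by rw [abs_le]; constructor <;> linarith)
    have h2 := H.shift (H.compl (mem_uniformClosure_self g i)) (a := r + g i x - 1)
      (by rw [abs_le]; constructor <;> linarith)
    refine ⟨_, H.inf hk (H.inf h1 h2), fun y => (min_le_left _ _).trans (hkr y), ?_, ?_⟩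
    · intro y j hj
      rcases Finset.mem_insert.1 hj with rfl | hj
      · refine (min_le_right _ _).trans ?_
        have := hy y
        grind
      · exact (min_le_left _ _).trans (hkS y j hj)
    · intro y d hd hdS
      have hi := hdS i (Finset.mem_insert_self _ _)
      have hk := hkd y d hd fun j hj => hdS j (Finset.mem_insert_of_mem hj)
      have := hy y
      rw [abs_le] at hi
      refine le_min hk (le_min ?_ ?_) <;> refine le_max_of_le_right (le_min ?_ ?_) <;> linarith

/-- Functions that are Lipschitz for finitely many `gᵢ` belong to the uniform closure. -/
theorem mem_of_lipschitz (H : IsApproxLattice g) [Nonempty ι] [Nonempty X] {S : Finset ι}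
    {h : X → ℝ} (h01 : ∀ x, h x ∈ Set.Icc (0 : ℝ) 1)
    (hS : ∀ x y, |h x - h y| ≤ finDist g S x y) : h ∈ uniformClosure g := by
  refine mem_uniformClosure_of_approx fun ε hε => ?_
  set G : X → S → ℝ := fun x i => g i x with hG
  -- No topology on X is needed: the finitely many gᵢ map X into a compact cube, so X has finite
  -- nets for `finDist g S`.
  have htb : TotallyBounded (Set.range G) := by
    refine (isCompact_univ_pi fun _ : S =>
      isCompact_Icc (a := (0 : ℝ)) (b := 1)).totallyBounded.subset ?_
    rintro _ ⟨x, rfl⟩ i -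
    exact H.mem_Icc i x
  obtain ⟨t, ht, htf, htc⟩ := Metric.finite_approx_of_totallyBounded htb (ε / 2) (by positivity)
  have hpre : ∀ q ∈ t, ∃ a, G a = q := fun q hq => ht hq
  choose! p hp using hpre
  have hcone := fun a : X => H.exists_cone a (h01 a) S
  choose k hk hkr hkS hkd using hcone
  have : Fintype t := htf.fintype
  obtain ⟨x₀⟩ := ‹Nonempty X›
  have hcover : ∀ y, ∃ q : t, finDist g S (p q) y ≤ ε / 2 := by
    intro y
    obtain ⟨q, hq, hyq⟩ := Set.mem_iUnion₂.1 (htc ⟨y, rfl⟩)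
    refine ⟨⟨q, hq⟩, ?_⟩
    have := hp q hq
    rw [Metric.mem_ball, dist_comm, ← this] at hyq
    exact hyq.le
  have hne : (Finset.univ : Finset t).Nonempty := ⟨(hcover x₀).choose, Finset.mem_univ _⟩
  -- The approximant is the maximum of the cones with apexes on the graph of h over an ε/2-net. All
  -- cones lie below h, and the one at a nearby net point loses ε/2 twice.
  refine ⟨Finset.univ.sup' hne fun q : t => k (p q),
    Finset.sup'_mem _ (fun a ha b hb => H.sup ha hb) _ hne _ fun q _ => hk _, fun y => ?_⟩
  rw [Finset.sup'_apply, abs_le]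
  have hk_le : ∀ a, k a y ≤ h y := by
    intro a
    by_cases h0 : k a y ≤ 0
    · exact h0.trans (h01 y).1
    have hd : finDist g S a y ≤ h a - k a y := by
      rw [finDist_le_iff (by linarith [hkr a y])]
      intro i hi
      have := (le_max_iff.1 (hkS a y i hi)).resolve_left h0
      linarith
    linarith [abs_le.1 ((hS a y).trans hd)]
  constructor
  · obtain ⟨q, hq⟩ := hcover y
    have h1 := hkd (p q) y (ε / 2) (by positivity) ((finDist_le_iff (by positivity)).1 hq)
    have h2 := abs_le.1 ((hS (p q) y).trans hq)
    have h3 := Finset.le_sup' (fun q : t => k (p q) y) (Finset.mem_univ q)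
    linarith
  · have := Finset.sup'_le hne (fun q : t => k (p q) y) fun q _ => hk_le (p q)
    linarith

end IsApproxLattice

theorem finDist_nonneg (g : ι → X → ℝ) (S : Finset ι) (x y : X) : 0 ≤ finDist g S x y :=
  dist_nonneg

theorem IsApproxLattice.finDist_le_one {g : ι → X → ℝ} (H : IsApproxLattice g) (S : Finset ι)
    (x y : X) : finDist g S x y ≤ 1 := by
  rw [finDist_le_iff zero_le_one]
  intro i _
  have := H.mem_Icc i x
  have := H.mem_Icc i y
  simp only [Set.mem_Icc] at *
  rw [abs_le]
  constructor <;> linarith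

end UniformClosure

-- Kantorovich duality

section Duality

variable {X ι : Type*} [MeasurableSpace X]

/-- The dual estimate: a pair of potentials dominating the cost `-sup_{i ∈ S} |gᵢ(x) - gᵢ(y)|`. -/
theorem IsApproxLattice.integral_add_integral_nonneg {g : ι → X → ℝ} (H : IsApproxLattice g)
    [Nonempty ι] (hg : ∀ i, Measurable (g i)) {μ ν : Measure X} [IsProbabilityMeasure μ]
    [IsProbabilityMeasure ν] {s : ℝ} (hs : ∀ i, |∫ x, g i x ∂μ - ∫ x, g i x ∂ν| ≤ s)
    {S : Finset ι} {φ ψ : X → ℝ} (hφ : Integrable φ μ) (hψ : Integrable ψ ν)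
    (h : ∀ x y, 0 ≤ φ x + ψ y + finDist g S x y) :
    0 ≤ ∫ x, φ x ∂μ + ∫ x, ψ x ∂ν + s := by
  have : Nonempty X := nonempty_of_isProbabilityMeasure μ
  obtain ⟨x₀⟩ := id this
  -- The inf-convolution of φ is 1-Lipschitz for `finDist g S` and squeezed as -ψ ≤ k ≤ φ, so one
  -- function replaces both potentials.
  set k : X → ℝ := fun y => ⨅ x, (φ x + finDist g S x y) with hk
  have hbdd : ∀ y, BddBelow (Set.range fun x => φ x + finDist g S x y) := by
    intro y
    refine ⟨-ψ y, ?_⟩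
    rintro _ ⟨x, rfl⟩
    linarith [h x y]
  have hkφ : ∀ y, k y ≤ φ y := fun y =>
    (ciInf_le (hbdd y) y).trans (by simp [finDist])
  have hkψ : ∀ y, -ψ y ≤ k y := fun y => le_ciInf fun x => by linarith [h x y]
  have hk1 : ∀ y z, k y - k z ≤ finDist g S y z := by
    intro y z
    have : k y - finDist g S y z ≤ k z := by
      refine le_ciInf fun x => ?_
      have h1 : k y ≤ φ x + finDist g S x y := ciInf_le (hbdd y) x
      have h2 : finDist g S x y ≤ finDist g S x z + finDist g S y z :=
        dist_triangle_right _ _ _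
      linarith
    linarith
  have hkb : BddBelow (Set.range k) := by
    refine ⟨k x₀ - 1, ?_⟩
    rintro _ ⟨y, rfl⟩
    linarith [hk1 x₀ y, H.finDist_le_one S x₀ y]
  -- Since `finDist` is at most 1, k - b takes values in [0, 1]. The constant b cancels in the
  -- difference of the integrals, as μ and ν have the same mass. Only gᵢ is integrated below, so k
  -- need not be measurable.
  set b := ⨅ y, k y with hb
  have hmem : (fun y => k y - b) ∈ uniformClosure g := by
    refine H.mem_of_lipschitz (S := S) (fun y => ⟨?_, ?_⟩) fun y z => ?_
    · linarith [ciInf_le hkb y]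
    · have : k y - 1 ≤ b := le_ciInf fun z => by linarith [hk1 y z, H.finDist_le_one S y z]
      linarith
    · have h1 := hk1 y z
      have h2 := hk1 z y
      rw [finDist, dist_comm] at h2
      rw [finDist] at h1 ⊢
      rw [abs_le]
      constructor <;> linarith
  refine le_of_forall_pos_le_add fun ε hε => ?_
  obtain ⟨i, hi⟩ := hmem (ε / 2) (by positivity)
  have hgi : ∀ (ρ : Measure X) [IsProbabilityMeasure ρ], Integrable (g i) ρ := fun ρ _ =>
    Integrable.of_mem_Icc 0 1 (hg i).aemeasurable (ae_of_all _ (H.mem_Icc i))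
  have h1 : ∫ x, g i x ∂μ + (b - ε / 2) ≤ ∫ x, φ x ∂μ := by
    have : ∫ x, (g i x + (b - ε / 2)) ∂μ = ∫ x, g i x ∂μ + (b - ε / 2) := by
      rw [integral_add (hgi μ) (integrable_const _)]; simp
    rw [← this]
    refine integral_mono ((hgi μ).add (integrable_const _)) hφ fun x => ?_
    have := abs_le.1 (hi x)
    have := hkφ x
    simp only
    linarith
  have h2 : -(∫ x, g i x ∂ν + (b + ε / 2)) ≤ ∫ x, ψ x ∂ν := by
    have : ∫ x, -(g i x + (b + ε / 2)) ∂ν = -(∫ x, g i x ∂ν + (b + ε / 2)) := by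
      rw [integral_neg, integral_add (hgi ν) (integrable_const _)]; simp
    rw [← this]
    refine integral_mono ((hgi ν).add (integrable_const _)).neg hψ fun x => ?_
    have := abs_le.1 (hi x)
    have := hkψ x
    simp only
    linarith
  linarith [abs_le.1 (hs i)]

end Duality

section Riesz

/-- Riesz-Markov: on a compact space every continuous function has compact support. -/
theorem exists_measure_integral_eq {K : Type*} [TopologicalSpace K] [CompactSpace K] [T2Space K]
    [MeasurableSpace K] [BorelSpace K] (L : C(K, ℝ) →ₗ[ℝ] ℝ) (hL : ∀ u : C(K, ℝ), 0 ≤ u → 0 ≤ L u) :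
    ∃ π : Measure K, IsFiniteMeasure π ∧ ∀ u : C(K, ℝ), ∫ k, u k ∂π = L u := by
  let Λ : CompactlySupportedContinuousMap K ℝ →ₚ[ℝ] ℝ := PositiveLinearMap.mk₀
    { toFun := fun u => L u.toContinuousMap
      map_add' := fun u v => L.map_add u.toContinuousMap v.toContinuousMap
      map_smul' := fun a u => L.map_smul a u.toContinuousMap }
    fun u hu => hL _ hu
  refine ⟨RealRMK.rieszMeasure Λ, inferInstance, fun u => ?_⟩
  exact RealRMK.integral_rieszMeasure Λ ⟨u, HasCompactSupport.of_compactSpace _⟩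

theorem _root_.ContinuousMap.integrable_of_compactSpace {K : Type*} [TopologicalSpace K]
    [CompactSpace K] [MeasurableSpace K] [OpensMeasurableSpace K] (u : C(K, ℝ))
    (μ : Measure K) [IsFiniteMeasure μ] : Integrable u μ :=
  (BoundedContinuousFunction.mkOfCompact u).integrable μ

end Riesz

section Duality

variable {X ι : Type*}

theorem finDist_mono (g : ι → X → ℝ) {S T : Finset ι} (h : S ⊆ T) (x y : X) :
    finDist g S x y ≤ finDist g T x y :=
  (finDist_le_iff (finDist_nonneg g T x y)).2 fun i hi =>
    (finDist_le_iff (finDist_nonneg g T x y)).1 le_rfl i (h hi)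

/-- The functions on `K × K` that dominate, along `F`, a nonnegative multiple of
`s - sup_{i ∈ S} |gᵢ(x) - gᵢ(y)|` for some finite `S`. -/
noncomputable def transportCone {K : Type*} [TopologicalSpace K] (g : ι → X → ℝ) (F : X → K)
    (s : ℝ) : PointedCone ℝ C(K × K, ℝ) where
  carrier := {u | ∃ a : ℝ, 0 ≤ a ∧ ∃ S : Finset ι, ∀ x y,
    a * (s - finDist g S x y) ≤ u (F x, F y)}
  zero_mem' := ⟨0, le_rfl, ∅, by simp⟩
  add_mem' := by
    classical
    rintro u v ⟨a, ha, S, hu⟩ ⟨b, hb, T, hv⟩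
    refine ⟨a + b, by positivity, S ∪ T, fun x y => ?_⟩
    have h1 := mul_le_mul_of_nonneg_left
      (finDist_mono g (Finset.subset_union_left (s₁ := S) (s₂ := T)) x y) ha
    have h2 := mul_le_mul_of_nonneg_left
      (finDist_mono g (Finset.subset_union_right (s₁ := S) (s₂ := T)) x y) hb
    have := hu x y
    have := hv x y
    simp only [ContinuousMap.add_apply]
    linarith
  smul_mem' := by
    rintro ⟨r, hr⟩ u ⟨a, ha, S, hu⟩
    refine ⟨r * a, by positivity, S, fun x y => ?_⟩
    have := mul_le_mul_of_nonneg_left (hu x y) hr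
    rw [mul_assoc]
    exact this

variable [MeasurableSpace X]

/-- The marginals prescribe a functional on the sums φ(k) + ψ(l). The dual estimate says that it is
nonnegative on those sums lying in `transportCone`, so it extends to a functional nonnegative on the
whole cone. The cone contains the nonnegative functions, which makes the extension a measure, and s
minus the finite costs, which bounds its cost. -/
theorem IsApproxLattice.exists_measure_prod {g : ι → X → ℝ} (H : IsApproxLattice g)
    [Nonempty ι] (hg : ∀ i, Measurable (g i)) {μ ν : Measure X} [IsProbabilityMeasure μ]
    [IsProbabilityMeasure ν] {s : ℝ} (hs : ∀ i, |∫ x, g i x ∂μ - ∫ x, g i x ∂ν| ≤ s)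
    {K : Type*} [TopologicalSpace K] [CompactSpace K] [T2Space K] [SecondCountableTopology K]
    [MeasurableSpace K] [BorelSpace K] {F : X → K} (hF : Measurable F) (G : ι → C(K, ℝ))
    (hG : ∀ i x, G i (F x) = g i x) :
    ∃ π : Measure (K × K), IsProbabilityMeasure π ∧ π.map Prod.fst = μ.map F ∧
      π.map Prod.snd = ν.map F ∧
      ∀ S : Finset ι, ∫ p, finDist (fun i => G i) S p.1 p.2 ∂π ≤ s := by
  have hFF : Measurable fun p : X × X => (F p.1, F p.2) := by fun_prop
  have hint : ∀ u : C(K × K, ℝ), Integrable (fun p : X × X => u (F p.1, F p.2)) (μ.prod ν) :=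
    fun u => by
      have := Measure.isProbabilityMeasure_map (μ := μ.prod ν) hFF.aemeasurable
      exact (u.integrable_of_compactSpace ((μ.prod ν).map _)).comp_measurable hFF
  have hintφ : ∀ (φ : C(K, ℝ)) (ρ : Measure X) [IsProbabilityMeasure ρ],
      Integrable (fun x => φ (F x)) ρ := fun φ ρ _ => by
    have := Measure.isProbabilityMeasure_map (μ := ρ) hF.aemeasurable
    exact (φ.integrable_of_compactSpace (ρ.map F)).comp_measurable hF
  -- Only the values of `I` on the range of `T` matter; the product measure makes them well defined,
  -- and nonnegative in the case a = 0.
  let I : C(K × K, ℝ) →ₗ[ℝ] ℝ :=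
    { toFun := fun u => ∫ p, u (F p.1, F p.2) ∂(μ.prod ν)
      map_add' := fun u v => integral_add (hint u) (hint v)
      map_smul' := fun a u => integral_const_mul a _ }
  let T : C(K, ℝ) × C(K, ℝ) →ₗ[ℝ] C(K × K, ℝ) :=
    LinearMap.coprod (ContinuousMap.compRightAlgHom ℝ ℝ ⟨Prod.fst, continuous_fst⟩).toLinearMap
      (ContinuousMap.compRightAlgHom ℝ ℝ ⟨Prod.snd, continuous_snd⟩).toLinearMap
  have hT : ∀ φ ψ k l, T (φ, ψ) (k, l) = φ k + ψ l := fun φ ψ k l => by simp [T]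
  have hIT : ∀ φ ψ, I (T (φ, ψ)) = ∫ x, φ (F x) ∂μ + ∫ x, ψ (F x) ∂ν := by
    intro φ ψ
    change ∫ p, T (φ, ψ) (F p.1, F p.2) ∂(μ.prod ν) = _
    simp only [hT]
    rw [integral_add ((hintφ φ μ).comp_fst ν) ((hintφ ψ ν).comp_snd μ),
      integral_fun_fst (μ := μ) (ν := ν) (fun x => φ (F x)),
      integral_fun_snd (μ := μ) (ν := ν) (fun x => ψ (F x))]
    simp
  obtain ⟨L, hLI, hLpos⟩ := riesz_extension (transportCone g F s)
    ⟨LinearMap.range T, I.domRestrict _⟩ (by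
      rintro ⟨_, ⟨φ, ψ⟩, rfl⟩ ⟨a, ha, S, hu⟩
      change 0 ≤ I (T (φ, ψ))
      rcases ha.eq_or_lt with rfl | ha
      · exact integral_nonneg fun p => by simpa using hu p.1 p.2
      rw [hIT]
      -- For a > 0, dividing by a and moving s into φ gives the normalized form of the dual
      -- estimate.
      have := H.integral_add_integral_nonneg hg hs (S := S)
        (φ := fun x => a⁻¹ * φ (F x) - s) (ψ := fun x => a⁻¹ * ψ (F x))
        (((hintφ φ μ).const_mul _).sub (integrable_const _)) ((hintφ ψ ν).const_mul _)
        fun x y => by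
          have := hu x y
          simp only [hT] at this
          have := mul_le_mul_of_nonneg_left this (inv_nonneg.2 ha.le)
          rw [inv_mul_cancel_left₀ ha.ne'] at this
          linarith
      rw [integral_sub ((hintφ φ μ).const_mul _) (integrable_const _), integral_const_mul,
        integral_const_mul] at this
      simp only [integral_const, probReal_univ, one_smul] at this
      have h2 := mul_nonneg ha.le this
      have : a * (a⁻¹ * ∫ x, φ (F x) ∂μ - s + a⁻¹ * ∫ x, ψ (F x) ∂ν + s) =
        ∫ x, φ (F x) ∂μ + ∫ x, ψ (F x) ∂ν := by field_simp; ring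
      linarith) (by
      intro u
      -- Cofinality for the extension theorem: u + ‖u‖ is nonnegative, hence in the cone with a = 0.
      refine ⟨⟨T (ContinuousMap.const K ‖u‖, 0), _, rfl⟩, 0, le_rfl, ∅, fun x y => ?_⟩
      have := abs_le.1 (u.norm_coe_le_norm (F x, F y))
      simp only [ContinuousMap.add_apply, hT]
      simp
      linarith)
  have hLT : ∀ φ ψ, L (T (φ, ψ)) = ∫ x, φ (F x) ∂μ + ∫ x, ψ (F x) ∂ν := fun φ ψ =>
    (hLI ⟨T (φ, ψ), _, rfl⟩).trans (hIT φ ψ)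
  obtain ⟨π, hπ, hπL⟩ := exists_measure_integral_eq L fun u hu =>
    hLpos u ⟨0, le_rfl, ∅, fun x y => by simpa using hu (F x, F y)⟩
  have hμF := Measure.isProbabilityMeasure_map (μ := μ) hF.aemeasurable
  have hνF := Measure.isProbabilityMeasure_map (μ := ν) hF.aemeasurable
  have hfst : π.map Prod.fst = μ.map F := by
    refine ext_of_forall_integral_eq_of_IsFiniteMeasure fun φ => ?_
    rw [integral_map measurable_fst.aemeasurable φ.continuous.aestronglyMeasurable,
      integral_map hF.aemeasurable φ.continuous.aestronglyMeasurable]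
    have h1 := hπL (T (φ.toContinuousMap, 0))
    rw [hLT] at h1
    simpa [hT, Prod.forall] using h1
  have hsnd : π.map Prod.snd = ν.map F := by
    refine ext_of_forall_integral_eq_of_IsFiniteMeasure fun φ => ?_
    rw [integral_map measurable_snd.aemeasurable φ.continuous.aestronglyMeasurable,
      integral_map hF.aemeasurable φ.continuous.aestronglyMeasurable]
    have h1 := hπL (T (0, φ.toContinuousMap))
    rw [hLT] at h1
    simpa [hT, Prod.forall] using h1
  refine ⟨π, ⟨?_⟩, hfst, hsnd, fun S => ?_⟩
  · rw [← Set.preimage_univ (f := Prod.fst), ← Measure.map_apply measurable_fst MeasurableSet.univ,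
      hfst, measure_univ]
  · let m : C(K × K, ℝ) := ⟨fun p => finDist (fun i => G i) S p.1 p.2, by
      unfold finDist; fun_prop⟩
    have h1 : L (T (ContinuousMap.const K s, 0)) = s := by rw [hLT]; simp
    -- The function s - m belongs to the cone with a = 1.
    have h2 := hLpos (T (ContinuousMap.const K s, 0) - m) ⟨1, zero_le_one, S, fun x y => by
      simp only [ContinuousMap.sub_apply, hT, m, ContinuousMap.coe_mk, finDist, hG]
      simp⟩
    rw [map_sub, h1, ← hπL] at h2
    exact sub_nonneg.1 h2

/-- Kantorovich duality, for costs that are suprema of a countable family of functions. -/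
theorem IsApproxLattice.transport_le {g : ι → X → ℝ} (H : IsApproxLattice g)
    [StandardBorelSpace X] [Nonempty ι] [Countable ι] (hg : ∀ i, Measurable (g i))
    {μ ν : Measure X} [IsProbabilityMeasure μ] [IsProbabilityMeasure ν] :
    transport (fun x y => ⨆ i, ENNReal.ofReal |g i x - g i y|) μ ν ≤
      ⨆ i, ENNReal.ofReal |∫ x, g i x ∂μ - ∫ x, g i x ∂ν| := by
  classical
  -- The gᵢ need not separate points, so a Cantor space coordinate is added to make `F` injective.
  obtain ⟨e, he, hei⟩ := MeasurableSpace.measurable_injection_nat_bool_of_countablySeparated X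
  set D := ⨆ i, ENNReal.ofReal |∫ x, g i x ∂μ - ∫ x, g i x ∂ν| with hD
  have hint : ∀ i (ρ : Measure X) [IsProbabilityMeasure ρ],
      ∫ x, g i x ∂ρ ∈ Set.Icc (0 : ℝ) 1 := by
    intro i ρ _
    have h1 : Integrable (g i) ρ :=
      Integrable.of_mem_Icc 0 1 (hg i).aemeasurable (ae_of_all _ (H.mem_Icc i))
    refine ⟨integral_nonneg fun x => (H.mem_Icc i x).1, ?_⟩
    simpa using integral_mono h1 (integrable_const 1) fun x => (H.mem_Icc i x).2
  have hDtop : D ≠ ∞ := by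
    refine ne_top_of_le_ne_top ENNReal.one_ne_top (iSup_le fun i => ?_)
    rw [ENNReal.ofReal_le_one, abs_le]
    have h1 := hint i μ
    have h2 := hint i ν
    rw [Set.mem_Icc] at h1 h2
    constructor <;> linarith
  have hs : ∀ i, |∫ x, g i x ∂μ - ∫ x, g i x ∂ν| ≤ D.toReal := fun i => by
    rw [← ENNReal.ofReal_le_iff_le_toReal hDtop]
    exact le_iSup (fun i => ENNReal.ofReal |∫ x, g i x ∂μ - ∫ x, g i x ∂ν|) i
  let F : X → (ι → unitInterval) × (ℕ → Bool) := fun x => (fun i => ⟨g i x, H.mem_Icc i x⟩, e x)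
  have hF : Measurable F :=
    (measurable_pi_lambda _ fun i => (hg i).subtype_mk).prodMk he
  have hFi : Function.Injective F := fun x y hxy => hei (congrArg Prod.snd hxy)
  -- Lusin-Souslin: an injective measurable map out of a standard Borel space has Borel range. Both
  -- marginals of π are carried by this range, so π pulls back without loss of mass.
  have hFe : MeasurableEmbedding F := hF.measurableEmbedding hFi
  have hFFe : MeasurableEmbedding (Prod.map F F) := hFe.prodMap hFe
  let G : ι → C((ι → unitInterval) × (ℕ → Bool), ℝ) := fun i =>
    ⟨fun k => (k.1 i : ℝ), by fun_prop⟩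
  obtain ⟨π, hπ, hfst, hsnd, hπS⟩ := H.exists_measure_prod hg hs hF G fun i x => rfl
  have hrange : MeasurableSet (Set.range F) := hFe.measurableSet_range
  have hmem1 : ∀ᵐ p ∂π, p.1 ∈ Set.range F := by
    refine ae_of_ae_map measurable_fst.aemeasurable ?_
    rw [hfst]
    exact (ae_map_mem_range F hrange μ)
  have hmem2 : ∀ᵐ p ∂π, p.2 ∈ Set.range F := by
    refine ae_of_ae_map measurable_snd.aemeasurable ?_
    rw [hsnd]
    exact (ae_map_mem_range F hrange ν)
  set γ := π.comap (Prod.map F F) with hγ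
  have hγπ : γ.map (Prod.map F F) = π := by
    rw [hγ, hFFe.map_comap, Measure.restrict_eq_self_of_ae_mem]
    filter_upwards [hmem1, hmem2] with p h1 h2
    rw [Set.range_prodMap]
    exact ⟨h1, h2⟩
  have hmap : ∀ ρ₁ ρ₂ : Measure X, ρ₁.map F = ρ₂.map F → ρ₁ = ρ₂ := by
    intro ρ₁ ρ₂ h
    rw [← hFe.comap_map ρ₁, h, hFe.comap_map]
  have hγc : γ ∈ couplings μ ν := by
    refine ⟨⟨?_⟩, hmap _ _ ?_, hmap _ _ ?_⟩
    · rw [← Set.preimage_univ (f := Prod.map F F),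
        ← Measure.map_apply hFFe.measurable MeasurableSet.univ, hγπ, measure_univ]
    · rw [Measure.map_map hF measurable_fst, ← hfst, ← hγπ,
        Measure.map_map measurable_fst hFFe.measurable]
      rfl
    · rw [Measure.map_map hF measurable_snd, ← hsnd, ← hγπ,
        Measure.map_map measurable_snd hFFe.measurable]
      rfl
  refine (iInf₂_le γ hγc).trans ?_
  have hsup : ∀ p : X × X, ⨆ i, ENNReal.ofReal |g i p.1 - g i p.2| ≤
      ⨆ S : Finset ι, ENNReal.ofReal (finDist g S p.1 p.2) := fun p => iSup_le fun i => by
    refine le_iSup_of_le {i} (ENNReal.ofReal_le_ofReal ?_)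
    exact (finDist_le_iff (finDist_nonneg g {i} _ _)).1 le_rfl i (by simp)
  have hmeas : ∀ S : Finset ι, Measurable fun p : X × X => finDist g S p.1 p.2 := by
    intro S
    unfold finDist
    fun_prop
  refine (lintegral_mono hsup).trans ?_
  -- Monotone convergence over finite subsets; countability of ι makes the directed family
  -- countable.
  rw [lintegral_iSup_directed (fun S => (hmeas S).ennreal_ofReal.aemeasurable)]
  · refine iSup_le fun S => ?_
    have hc : Continuous fun p : ((ι → unitInterval) × (ℕ → Bool)) × _ =>
        finDist (fun i => G i) S p.1 p.2 := by
      unfold finDist; fun_prop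
    have h1 : ∫⁻ p, ENNReal.ofReal (finDist g S p.1 p.2) ∂γ =
        ∫⁻ p, ENNReal.ofReal (finDist (fun i => G i) S p.1 p.2) ∂π := by
      rw [← hγπ, lintegral_map hc.measurable.ennreal_ofReal hFFe.measurable]
      rfl
    have h2 : Integrable (fun p : ((ι → unitInterval) × (ℕ → Bool)) × _ =>
        finDist (fun i => G i) S p.1 p.2) π :=
      ContinuousMap.integrable_of_compactSpace ⟨_, hc⟩ π
    rw [h1, ← ofReal_integral_eq_lintegral_ofReal h2
      (ae_of_all _ fun p => finDist_nonneg _ S p.1 p.2)]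
    exact ENNReal.ofReal_le_of_le_toReal (hπS S)
  · intro S T
    exact ⟨S ∪ T,
      fun p => ENNReal.ofReal_le_ofReal (finDist_mono g Finset.subset_union_left _ _),
      fun p => ENNReal.ofReal_le_ofReal (finDist_mono g Finset.subset_union_right _ _)⟩

end Duality

-- The trajectory space is standard Borel

section StandardBorel

theorem denseRange_nnratCast_nnreal : DenseRange ((↑) : ℚ≥0 → ℝ≥0) := by
  refine dense_of_exists_between fun a b hab => ?_
  obtain ⟨q, hq0, hq1, hq2⟩ := NNReal.lt_iff_exists_rat_btwn a b |>.1 hab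
  lift q to ℚ≥0 using hq0
  have : Real.toNNReal ((q : ℚ) : ℝ) = (q : ℝ≥0) := by
    ext
    rw [Real.coe_toNNReal _ (by positivity)]
    norm_cast
  exact ⟨q, ⟨q, rfl⟩, this ▸ hq1, this ▸ hq2⟩

/-- By Lusin-Souslin r is an embedding for the Borel σ-algebra, so every Borel set is a preimage
under r and already lies in m. -/
theorem standardBorelSpace_of_le_borel {Y Z : Type*} [TopologicalSpace Y] [PolishSpace Y]
    {m : MeasurableSpace Y} [MeasurableSpace Z] [MeasurableSpace.CountablySeparated Z]
    (hle : m ≤ borel Y) {r : Y → Z} (hr : Measurable[m] r) (hri : Function.Injective r) :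
    @StandardBorelSpace Y m := by
  have hm : m = borel Y := by
    refine le_antisymm hle ?_
    have hr' : Measurable[borel Y] r := hr.mono hle le_rfl
    let _ : MeasurableSpace Y := borel Y
    have : BorelSpace Y := ⟨rfl⟩
    rw [← (hr'.measurableEmbedding hri).comap_eq]
    exact hr.comap_le
  exact @StandardBorelSpace.mk Y m ⟨inferInstance, @BorelSpace.mk Y _ m hm, inferInstance⟩

variable (E : Type*) [TopologicalSpace E]

/-- A locally compact space is open in its completion: the image of a compact neighbourhood is
closed there, and its closure is a neighbourhood by density. -/
theorem polishSpace_of_locallyCompact [LocallyCompactSpace E] [T2Space E]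
    [SecondCountableTopology E] : PolishSpace E := by
  let := TopologicalSpace.metrizableSpaceMetric E
  let f : E → UniformSpace.Completion E := (↑)
  have hf : IsDenseInducing f := UniformSpace.Completion.isDenseInducing_coe
  have hfe : IsEmbedding f := (UniformSpace.Completion.coe_isometry (α := E)).isEmbedding
  have hopen : IsOpen (Set.range f) := by
    rw [isOpen_iff_mem_nhds]
    rintro _ ⟨x, rfl⟩
    obtain ⟨K, hK, hKx⟩ := exists_compact_mem_nhds x
    have h1 := hf.closure_image_mem_nhds hKx
    rw [(hK.image hf.continuous).isClosed.closure_eq] at h1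
    exact Filter.mem_of_superset h1 (Set.image_subset_range f K)
  have := hopen.polishSpace
  exact (hfe.toHomeomorph.isClosedEmbedding).polishSpace

theorem polishSpace_trajectory [PolishSpace E] : PolishSpace (Trajectory E) := by
  let := TopologicalSpace.upgradeIsCompletelyMetrizable E
  infer_instance

variable [MeasurableSpace E]

theorem measurable_eval (s : ℝ≥0) : Measurable fun ω : Trajectory E => ω s :=
  measurable_iff_comap_le.2 (le_iSup (fun s : ℝ≥0 =>
    MeasurableSpace.comap (fun ω : Trajectory E => ω s) inferInstance) s)

/-- The countably many coordinates at rational times determine a continuous path. -/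
theorem standardBorelSpace_trajectory [BorelSpace E] [PolishSpace E] :
    StandardBorelSpace (Trajectory E) := by
  have := polishSpace_trajectory E
  refine standardBorelSpace_of_le_borel (r := fun (ω : Trajectory E) (q : ℚ≥0) => ω (q : ℝ≥0))
    (iSup_le fun s => ?_) (measurable_pi_lambda _ fun q => measurable_eval E _)
    fun ω ω' h => DFunLike.coe_injective (denseRange_nnratCast_nnreal.equalizer ω.continuous
      ω'.continuous h)
  rw [BorelSpace.measurable_eq (α := E)]
  exact (borel_comap (f := fun ω : Trajectory E => ω s)).symm.le.trans
    (borel_anti (continuous_eval_const s).le_induced)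

end StandardBorel

-- Elementary transport bounds

section Transport

variable {X : Type*} [MeasurableSpace X]

theorem transport_mono {k l : X → X → ℝ≥0∞} (h : ∀ x y, k x y ≤ l x y) (μ ν : Measure X) :
    transport k μ ν ≤ transport l μ ν :=
  iInf₂_mono fun _ _ => lintegral_mono fun p => h p.1 p.2

theorem le_transport_of_ae {k : X → X → ℝ≥0∞} {μ ν : Measure X} {a : ℝ≥0∞} {p q : X → Prop}
    (hp : ∀ᵐ x ∂μ, p x) (hq : ∀ᵐ y ∂ν, q y) (h : ∀ x y, p x → q y → a ≤ k x y) :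
    a ≤ transport k μ ν := by
  refine le_iInf₂ fun γ ⟨hγ, h1, h2⟩ => ?_
  rw [← h1] at hp
  rw [← h2] at hq
  calc a = ∫⁻ _, a ∂γ := by simp
    _ ≤ _ := lintegral_mono_ae (by
      filter_upwards [ae_of_ae_map measurable_fst.aemeasurable hp,
        ae_of_ae_map measurable_snd.aemeasurable hq] with z hz1 hz2
      exact h _ _ hz1 hz2)

/-- The easy half of duality: under any coupling the difference of integrals is ∫ (f(x) - f(y)) dγ.
-/
theorem ofReal_abs_integral_sub_le_transport {k : X → X → ℝ≥0∞} {μ ν : Measure X}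
    {f : X → ℝ} (hf : Measurable f) (hfμ : Integrable f μ) (hfν : Integrable f ν)
    (h : ∀ x y, ENNReal.ofReal |f x - f y| ≤ k x y) :
    ENNReal.ofReal |∫ x, f x ∂μ - ∫ x, f x ∂ν| ≤ transport k μ ν := by
  refine le_iInf₂ fun γ ⟨hγ, h1, h2⟩ => ?_
  have i1 : Integrable (fun z : X × X => f z.1) γ :=
    Integrable.comp_measurable (by rwa [h1]) measurable_fst
  have i2 : Integrable (fun z : X × X => f z.2) γ :=
    Integrable.comp_measurable (by rwa [h2]) measurable_snd
  rw [← h1, ← h2, integral_map measurable_fst.aemeasurable hf.aestronglyMeasurable,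
    integral_map measurable_snd.aemeasurable hf.aestronglyMeasurable, ← integral_sub i1 i2,
    ← Real.norm_eq_abs, ofReal_norm]
  refine (enorm_integral_le_lintegral_enorm _).trans (lintegral_mono fun z => ?_)
  rw [← ofReal_norm, Real.norm_eq_abs]
  exact h _ _

end Transport

-- Countability of the logics

section Countable

/-- An injective numbering of the expressions of `Λ`. -/
def KernelFormula.code (e : Set.Icc (0 : ℚ) 1 → ℕ) (e' : ℚ≥0 → ℕ) : KernelFormula → ℕ
  | .const q => Nat.pair 0 (e q)
  | .obs => Nat.pair 1 0
  | .min f₁ f₂ => Nat.pair 2 (Nat.pair (f₁.code e e') (f₂.code e e'))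
  | .compl f => Nat.pair 3 (f.code e e')
  | .tsub f q => Nat.pair 4 (Nat.pair (f.code e e') (e q))
  | .diamond t f => Nat.pair 5 (Nat.pair (e' t) (f.code e e'))

theorem KernelFormula.code_injective {e : Set.Icc (0 : ℚ) 1 → ℕ} {e' : ℚ≥0 → ℕ}
    (he : Function.Injective e) (he' : Function.Injective e') :
    Function.Injective (KernelFormula.code e e') := by
  intro f
  induction f <;> intro g hg <;> cases g <;>
    simp_all [KernelFormula.code, Nat.pair_eq_pair, he.eq_iff, he'.eq_iff, Function.Injective]
  all_goals aesop

instance : Countable KernelFormula := by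
  obtain ⟨e, he⟩ := exists_injective_nat (Set.Icc (0 : ℚ) 1)
  obtain ⟨e', he'⟩ := exists_injective_nat ℚ≥0
  exact (KernelFormula.code_injective he he').countable

mutual

/-- An injective numbering of the expressions of `𝓛_σ`. -/
def StateFormula.code (e : Set.Icc (0 : ℚ) 1 → ℕ) (e' : ℚ≥0 → ℕ) : StateFormula → ℕ
  | .const q => Nat.pair 0 (e q)
  | .obs => Nat.pair 1 0
  | .compl f => Nat.pair 2 (f.code e e')
  | .integral g => Nat.pair 3 (g.code e e')

/-- An injective numbering of the expressions of `𝓛_τ`. -/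
def TrajFormula.code (e : Set.Icc (0 : ℚ) 1 → ℕ) (e' : ℚ≥0 → ℕ) : TrajFormula → ℕ
  | .ev f t => Nat.pair 0 (Nat.pair (f.code e e') (e' t))
  | .min g₁ g₂ => Nat.pair 1 (Nat.pair (g₁.code e e') (g₂.code e e'))
  | .max g₁ g₂ => Nat.pair 2 (Nat.pair (g₁.code e e') (g₂.code e e'))
  | .tsub g q => Nat.pair 3 (Nat.pair (g.code e e') (e q))
  | .tadd g q => Nat.pair 4 (Nat.pair (g.code e e') (e q))

end

mutual

theorem StateFormula.eq_of_code_eq {e : Set.Icc (0 : ℚ) 1 → ℕ} {e' : ℚ≥0 → ℕ}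
    (he : Function.Injective e) (he' : Function.Injective e') :
    ∀ f f' : StateFormula, f.code e e' = f'.code e e' → f = f'
  | .const q, f', h => by
    cases f' <;> simp [StateFormula.code, Nat.pair_eq_pair, he.eq_iff] at h ⊢; grind
  | .obs, f', h => by
    cases f' <;> simp [StateFormula.code, Nat.pair_eq_pair] at h ⊢
  | .compl f, f', h => by
    have ih := StateFormula.eq_of_code_eq he he' f
    cases f' <;> simp [StateFormula.code, Nat.pair_eq_pair] at h ⊢; grind
  | .integral g, f', h => by
    have ih := TrajFormula.eq_of_code_eq he he' g
    cases f' <;> simp [StateFormula.code, Nat.pair_eq_pair] at h ⊢; grind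

theorem TrajFormula.eq_of_code_eq {e : Set.Icc (0 : ℚ) 1 → ℕ} {e' : ℚ≥0 → ℕ}
    (he : Function.Injective e) (he' : Function.Injective e') :
    ∀ g g' : TrajFormula, g.code e e' = g'.code e e' → g = g'
  | .ev f t, g', h => by
    have ih := StateFormula.eq_of_code_eq he he' f
    cases g' <;> simp [TrajFormula.code, Nat.pair_eq_pair, he'.eq_iff] at h ⊢; grind
  | .min g₁ g₂, g', h => by
    have ih₁ := TrajFormula.eq_of_code_eq he he' g₁
    have ih₂ := TrajFormula.eq_of_code_eq he he' g₂
    cases g' <;> simp [TrajFormula.code, Nat.pair_eq_pair] at h ⊢; grind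
  | .max g₁ g₂, g', h => by
    have ih₁ := TrajFormula.eq_of_code_eq he he' g₁
    have ih₂ := TrajFormula.eq_of_code_eq he he' g₂
    cases g' <;> simp [TrajFormula.code, Nat.pair_eq_pair] at h ⊢; grind
  | .tsub g q, g', h => by
    have ih := TrajFormula.eq_of_code_eq he he' g
    cases g' <;> simp [TrajFormula.code, Nat.pair_eq_pair, he.eq_iff] at h ⊢; grind
  | .tadd g q, g', h => by
    have ih := TrajFormula.eq_of_code_eq he he' g
    cases g' <;> simp [TrajFormula.code, Nat.pair_eq_pair, he.eq_iff] at h ⊢; grind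

end

instance : Countable TrajFormula := by
  obtain ⟨e, he⟩ := exists_injective_nat (Set.Icc (0 : ℚ) 1)
  obtain ⟨e', he'⟩ := exists_injective_nat ℚ≥0
  exact Function.Injective.countable (f := TrajFormula.code e e')
    fun g g' => TrajFormula.eq_of_code_eq he he' g g'

instance : Nonempty KernelFormula := ⟨.obs⟩

instance : Nonempty TrajFormula := ⟨.ev .obs 0⟩

end Countable

-- Regularity of the kernels and path laws

namespace Diffusion

variable {E : Type*} [TopologicalSpace E] [MeasurableSpace E] (D : Diffusion E)

instance (t : ℝ≥0) : IsMarkovKernel (D.kernel t) := D.honest t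

instance (x : E) : IsProbabilityMeasure (D.law x) := D.law_prob x

theorem map_eval_zero_law (x : E) : (D.law x).map (fun ω => ω 0) = Measure.dirac x := by
  ext C hC
  rw [Measure.map_apply (measurable_eval E 0) hC]
  have h := D.law_cylinder x C [] hC (by simp) (by simp)
  simpa [cylinderProb, Set.preimage] using h

theorem ae_law_zero [MeasurableSingletonClass E] (x : E) : ∀ᵐ ω ∂(D.law x), ω 0 = x := by
  refine ae_of_ae_map (measurable_eval E 0).aemeasurable (p := fun y => y = x) ?_
  rw [D.map_eval_zero_law]
  exact (ae_dirac_iff (measurableSet_singleton x)).2 rfl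

theorem continuous_integral_law [SecondCountableTopology E] {g : Trajectory E → ℝ} (hg : Continuous g)
    (hg1 : ∀ ω, g ω ∈ Set.Icc (0 : ℝ) 1) : Continuous fun x => ∫ ω, g ω ∂(D.law x) := by
  refine continuous_iff_seqContinuous.2 fun u x hu => ?_
  exact D.law_continuous u x hu (BoundedContinuousFunction.ofNormedAddCommGroup g hg 1 fun ω => by
    rw [Real.norm_eq_abs, abs_of_nonneg (hg1 ω).1]
    exact (hg1 ω).2)

variable [BorelSpace E] [LocallyCompactSpace E] [T2Space E] [SecondCountableTopology E]

/-- The cylinder formula only involves positive times, so time 0 comes from P̂₀ = I. -/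
theorem kernel_zero (x : E) : D.kernel 0 x = Measure.dirac x := by
  have := polishSpace_of_locallyCompact E
  refine Measure.ext_of_integral_eq_on_compactlySupported fun f => ?_
  have h := D.op_eq_integral 0 (f : C₀(E, ℝ)) x
  rw [D.op_zero] at h
  rw [integral_dirac]
  exact h.symm

theorem map_eval_law (t : ℝ≥0) (x : E) : (D.law x).map (fun ω => ω t) = D.kernel t x := by
  rcases eq_or_ne t 0 with rfl | ht
  · rw [D.map_eval_zero_law, D.kernel_zero]
  ext C hC
  rw [Measure.map_apply (measurable_eval E t) hC]
  have h := D.law_cylinder x Set.univ [(t, C)] MeasurableSet.univ (by simpa using hC)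
    (by simpa using pos_iff_ne_zero.2 ht)
  simpa [cylinderProb, Set.preimage] using h

theorem integral_kernel {f : E → ℝ} (hf : Measurable f) (t : ℝ≥0) (x : E) :
    ∫ y, f y ∂(D.kernel t x) = ∫ ω, f (ω t) ∂(D.law x) := by
  rw [← D.map_eval_law, integral_map (measurable_eval E t).aemeasurable hf.aestronglyMeasurable]

/-- Here f need not vanish at infinity; weak continuity of the path laws takes the place of the
action on C₀(E). -/
theorem continuous_integral_kernel {f : E → ℝ} (hf : Continuous f)
    (hf1 : ∀ x, f x ∈ Set.Icc (0 : ℝ) 1) (t : ℝ≥0) :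
    Continuous fun x => ∫ y, f y ∂(D.kernel t x) := by
  simp only [D.integral_kernel hf.measurable]
  exact D.continuous_integral_law (hf.comp (continuous_eval_const t)) fun ω => hf1 _

/-- Dominated convergence along continuous paths. -/
theorem continuous_integral_kernel_time {f : E → ℝ} (hf : Continuous f)
    (hf1 : ∀ x, f x ∈ Set.Icc (0 : ℝ) 1) (x : E) :
    Continuous fun t : ℝ≥0 => ∫ y, f y ∂(D.kernel t x) := by
  simp only [D.integral_kernel hf.measurable]
  refine continuous_of_dominated (bound := fun _ => 1)
    (fun t => (hf.measurable.comp (measurable_eval E t)).aestronglyMeasurable)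
    (fun t => ae_of_all _ fun ω => ?_) (integrable_const _) (ae_of_all _ fun ω => by fun_prop)
  rw [Real.norm_eq_abs, abs_of_nonneg (hf1 _).1]
  exact (hf1 _).2

end Diffusion

theorem integral_mem_Icc {X : Type*} [MeasurableSpace X] {μ : Measure X} [IsProbabilityMeasure μ]
    {f : X → ℝ} (hf : Measurable f) (h : ∀ x, f x ∈ Set.Icc (0 : ℝ) 1) :
    Integrable f μ ∧ ∫ x, f x ∂μ ∈ Set.Icc (0 : ℝ) 1 := by
  have h1 : Integrable f μ := Integrable.of_mem_Icc 0 1 hf.aemeasurable (ae_of_all _ h)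
  refine ⟨h1, integral_nonneg fun x => (h x).1, ?_⟩
  simpa using integral_mono h1 (integrable_const 1) fun x => (h x).2

-- Discounting and Lipschitz bounds for the connectives

section Discount

variable {c : ℝ}

theorem rpow_mem_Icc (hc0 : 0 < c) (hc1 : c < 1) {t : ℝ} (ht : 0 ≤ t) :
    c ^ t ∈ Set.Icc (0 : ℝ) 1 :=
  ⟨(Real.rpow_pos_of_pos hc0 t).le, Real.rpow_le_one hc0.le hc1.le ht⟩

theorem mul_mem_Icc {a b : ℝ} (ha : a ∈ Set.Icc (0 : ℝ) 1) (hb : b ∈ Set.Icc (0 : ℝ) 1) :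
    a * b ∈ Set.Icc (0 : ℝ) 1 :=
  ⟨mul_nonneg ha.1 hb.1, mul_le_one₀ ha.2 hb.1 hb.2⟩

theorem ofReal_rpow_mul (hc0 : 0 < c) (t a b : ℝ) :
    ENNReal.ofReal (c ^ t) * ENNReal.ofReal |a - b| = ENNReal.ofReal |c ^ t * a - c ^ t * b| := by
  have := (Real.rpow_pos_of_pos hc0 t).le
  rw [← ENNReal.ofReal_mul this, ← mul_sub, abs_mul, abs_of_nonneg this]

theorem coe_nnratCast_nnreal (q : ℚ≥0) : ((q : ℝ≥0) : ℝ) = q := by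
  norm_cast

theorem ofReal_rpow_mul_le_of_rat (hc0 : 0 < c) {u v : ℝ≥0 → ℝ} (hu : Continuous u)
    (hv : Continuous v) {a : ℝ≥0∞}
    (h : ∀ q : ℚ≥0, ENNReal.ofReal |c ^ (q : ℝ) * u q - c ^ (q : ℝ) * v q| ≤ a) (t : ℝ≥0) :
    ENNReal.ofReal (c ^ (t : ℝ)) * ENNReal.ofReal |u t - v t| ≤ a := by
  rw [ofReal_rpow_mul hc0]
  have hc : Continuous fun t : ℝ≥0 => c ^ (t : ℝ) :=
    (Real.continuous_const_rpow hc0.ne').comp NNReal.continuous_coe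
  refine denseRange_nnratCast_nnreal.induction_on
    (p := fun t : ℝ≥0 => ENNReal.ofReal |c ^ (t : ℝ) * u t - c ^ (t : ℝ) * v t| ≤ a) t ?_ ?_
  · exact isClosed_le (ENNReal.continuous_ofReal.comp
      ((hc.mul hu).sub (hc.mul hv)).abs) continuous_const
  · intro q
    simpa only [coe_nnratCast_nnreal] using h q

theorem ofReal_abs_mono {a b : ℝ} {r : ℝ≥0∞} (h : |a| ≤ |b|) (hb : ENNReal.ofReal |b| ≤ r) :
    ENNReal.ofReal |a| ≤ r :=
  (ENNReal.ofReal_le_ofReal h).trans hb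

theorem ofReal_abs_le_of_le_max {a b d : ℝ} {r : ℝ≥0∞} (h : |a| ≤ max |b| |d|)
    (hb : ENNReal.ofReal |b| ≤ r) (hd : ENNReal.ofReal |d| ≤ r) : ENNReal.ofReal |a| ≤ r := by
  rcases le_max_iff.1 h with h | h
  · exact ofReal_abs_mono h hb
  · exact ofReal_abs_mono h hd

theorem abs_max_zero_sub_sub_le (a b q : ℝ) : |max 0 (a - q) - max 0 (b - q)| ≤ |a - b| := by
  simpa using abs_max_sub_max_le_max 0 (a - q) 0 (b - q)

theorem abs_min_one_add_sub_le (a b q : ℝ) : |min 1 (a + q) - min 1 (b + q)| ≤ |a - b| := by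
  simpa using abs_min_sub_min_le_max 1 (a + q) 1 (b + q)

theorem ratCast_mem_Icc (q : Set.Icc (0 : ℚ) 1) : ((q : ℚ) : ℝ) ∈ Set.Icc (0 : ℝ) 1 :=
  ⟨by exact_mod_cast q.2.1, by exact_mod_cast q.2.2⟩

end Discount

theorem discountedUniform_mono {E : Type*} [TopologicalSpace E] {c : ℝ}
    {m m' : E → E → ℝ≥0∞} (h : ∀ x y, m x y ≤ m' x y)
    (ω ω' : Trajectory E) : discountedUniform c m ω ω' ≤ discountedUniform c m' ω ω' :=
  iSup_mono fun _ => mul_le_mul_right (h _ _) _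

theorem le_discountedUniform {E : Type*} [TopologicalSpace E] {c : ℝ} (m : E → E → ℝ≥0∞)
    (ω ω' : Trajectory E) (t : ℝ≥0) :
    ENNReal.ofReal (c ^ (t : ℝ)) * m (ω t) (ω' t) ≤ discountedUniform c m ω ω' :=
  le_iSup (fun t : ℝ≥0 => ENNReal.ofReal (c ^ (t : ℝ)) * m (ω t) (ω' t)) t

variable {E : Type*} [TopologicalSpace E] [MeasurableSpace E] (D : Diffusion E)
  (obs : C(E, unitInterval)) {c : ℝ}

-- Monotone iteration and comparison of the functionals

section Monotone

theorem kernelFunctional_mono {m m' : E → E → ℝ≥0∞} (h : ∀ x y, m x y ≤ m' x y) (x y : E) :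
    kernelFunctional D c m x y ≤ kernelFunctional D c m' x y :=
  iSup_mono fun _ => mul_le_mul_right (transport_mono h _ _) _

theorem trajFunctional_mono {m m' : E → E → ℝ≥0∞} (h : ∀ x y, m x y ≤ m' x y) (x y : E) :
    trajFunctional D c m x y ≤ trajFunctional D c m' x y :=
  transport_mono (discountedUniform_mono h) _ _

/-- Time 0 carries no discount, and the paths start almost surely at x and y. -/
theorem le_trajFunctional [MeasurableSingletonClass E] (m : E → E → ℝ≥0∞) (x y : E) :
    m x y ≤ trajFunctional D c m x y :=
  le_transport_of_ae (D.ae_law_zero x) (D.ae_law_zero y) fun ω ω' h h' => by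
    have := le_discountedUniform (c := c) m ω ω' 0
    simpa [h, h'] using this

theorem dSeq_monotone [MeasurableSingletonClass E] (x y : E) :
    Monotone fun n => dSeq D obs c n x y :=
  monotone_nat_of_le_succ fun n => le_trajFunctional D (dSeq D obs c n) x y

variable [BorelSpace E] [LocallyCompactSpace E] [T2Space E] [SecondCountableTopology E]

theorem le_kernelFunctional (m : E → E → ℝ≥0∞) (x y : E) :
    m x y ≤ kernelFunctional D c m x y := by
  refine le_iSup_of_le 0 ?_
  rw [D.kernel_zero, D.kernel_zero]
  simpa using le_transport_of_ae (k := m) (p := fun z => z = x) (q := fun z => z = y)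
    ((ae_dirac_iff (measurableSet_singleton x)).2 rfl)
    ((ae_dirac_iff (measurableSet_singleton y)).2 rfl) (by rintro _ _ rfl rfl; rfl)

theorem deltaSeq_monotone (x y : E) : Monotone fun n => deltaSeq D obs c n x y :=
  monotone_nat_of_le_succ fun n => le_kernelFunctional D (deltaSeq D obs c n) x y

/-- A coupling of two laws on the trajectories induces couplings of the transition kernels. -/
theorem kernelFunctional_le_trajFunctional (m : E → E → ℝ≥0∞) (x y : E) :
    kernelFunctional D c m x y ≤ trajFunctional D c m x y := by
  refine iSup_le fun t => le_iInf₂ fun γ ⟨hγ, h1, h2⟩ => ?_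
  have he := measurable_eval E t
  have hee : Measurable fun p : Trajectory E × Trajectory E => (p.1 t, p.2 t) :=
    (he.comp measurable_fst).prodMk (he.comp measurable_snd)
  have hc : γ.map (fun p => (p.1 t, p.2 t)) ∈ couplings (D.kernel t x) (D.kernel t y) := by
    refine ⟨Measure.isProbabilityMeasure_map hee.aemeasurable, ?_, ?_⟩
    · rw [← D.map_eval_law, ← h1, Measure.map_map measurable_fst hee,
        Measure.map_map he measurable_fst]
      rfl
    · rw [← D.map_eval_law, ← h2, Measure.map_map measurable_snd hee,
        Measure.map_map he measurable_snd]
      rfl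
  -- The cost m may fail to be measurable; each comparison of integrals used here holds in this
  -- direction regardless.
  calc _ ≤ ENNReal.ofReal (c ^ (t : ℝ)) * ∫⁻ p, m (p.1 t) (p.2 t) ∂γ :=
        mul_le_mul_right ((iInf₂_le _ hc).trans (lintegral_map_le _ _)) _
    _ ≤ ∫⁻ p, ENNReal.ofReal (c ^ (t : ℝ)) * m (p.1 t) (p.2 t) ∂γ := lintegral_const_mul_le _ _
    _ ≤ _ := lintegral_mono fun p => le_discountedUniform m p.1 p.2 t

theorem deltaSeq_le_dSeq (n : ℕ) (x y : E) : deltaSeq D obs c n x y ≤ dSeq D obs c n x y := by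
  induction n generalizing x y with
  | zero => exact le_rfl
  | succ n ih =>
    exact (kernelFunctional_mono D ih x y).trans (kernelFunctional_le_trajFunctional D _ x y)

end Monotone

-- The kernel-based logic

section Kernel

variable [BorelSpace E] [LocallyCompactSpace E] [T2Space E] [SecondCountableTopology E]

theorem KernelFormula.eval_mem_and_continuous (hc0 : 0 < c) (hc1 : c < 1) (f : KernelFormula) :
    (∀ x, f.eval D obs c x ∈ Set.Icc (0 : ℝ) 1) ∧ Continuous (f.eval D obs c) := by
  induction f with
  | const q => exact ⟨fun x => ratCast_mem_Icc q, continuous_const⟩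
  | obs => exact ⟨fun x => (obs x).2, by simp only [KernelFormula.eval]; fun_prop⟩
  | min f₁ f₂ ih₁ ih₂ =>
    exact ⟨fun x => ⟨le_min (ih₁.1 x).1 (ih₂.1 x).1, min_le_of_left_le (ih₁.1 x).2⟩,
      ih₁.2.min ih₂.2⟩
  | compl f ih =>
    exact ⟨fun x => Set.Icc.mem_iff_one_sub_mem.1 (ih.1 x), continuous_const.sub ih.2⟩
  | tsub f q ih =>
    exact ⟨fun x => ⟨le_max_left _ _, max_le zero_le_one
      (by linarith [(ih.1 x).2, (ratCast_mem_Icc q).1])⟩,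
      continuous_const.max (ih.2.sub continuous_const)⟩
  | diamond t f ih =>
    exact ⟨fun x => mul_mem_Icc (rpow_mem_Icc hc0 hc1 (by positivity))
      (integral_mem_Icc ih.2.measurable ih.1).2,
      continuous_const.mul (D.continuous_integral_kernel ih.2 ih.1 _)⟩

theorem KernelFormula.exists_le_deltaSeq (hc0 : 0 < c) (hc1 : c < 1) (f : KernelFormula) :
    ∃ n, ∀ x y, ENNReal.ofReal |f.eval D obs c x - f.eval D obs c y| ≤ deltaSeq D obs c n x y := by
  induction f with
  | const q => exact ⟨0, by simp [KernelFormula.eval]⟩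
  | obs => exact ⟨0, fun x y => le_rfl⟩
  | min f₁ f₂ ih₁ ih₂ =>
    obtain ⟨n, hn⟩ := ih₁
    obtain ⟨k, hk⟩ := ih₂
    exact ⟨n + k, fun x y => ofReal_abs_le_of_le_max (abs_min_sub_min_le_max _ _ _ _)
      ((hn x y).trans (deltaSeq_monotone D obs x y (Nat.le_add_right n k)))
      ((hk x y).trans (deltaSeq_monotone D obs x y (Nat.le_add_left k n)))⟩
  | compl f ih =>
    obtain ⟨n, hn⟩ := ih
    refine ⟨n, fun x y => ofReal_abs_mono (le_of_eq ?_) (hn x y)⟩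
    simp only [KernelFormula.eval]
    rw [sub_sub_sub_cancel_left, abs_sub_comm]
  | tsub f q ih =>
    obtain ⟨n, hn⟩ := ih
    exact ⟨n, fun x y => ofReal_abs_mono (abs_max_zero_sub_sub_le _ _ _) (hn x y)⟩
  | diamond t f ih =>
    obtain ⟨n, hn⟩ := ih
    obtain ⟨h01, hf⟩ := f.eval_mem_and_continuous D obs hc0 hc1
    refine ⟨n + 1, fun x y => ?_⟩
    simp only [KernelFormula.eval]
    rw [← ofReal_rpow_mul hc0]
    refine le_trans ?_ (le_iSup (fun t : ℝ≥0 => ENNReal.ofReal (c ^ (t : ℝ)) *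
      transport (deltaSeq D obs c n) (D.kernel t x) (D.kernel t y)) (t : ℝ≥0))
    simp only [coe_nnratCast_nnreal]
    exact mul_le_mul_right (ofReal_abs_integral_sub_le_transport hf.measurable
      (integral_mem_Icc hf.measurable h01).1 (integral_mem_Icc hf.measurable h01).1 hn) _

theorem isApproxLattice_kernelFormula (hc0 : 0 < c) (hc1 : c < 1) :
    IsApproxLattice fun f : KernelFormula => f.eval D obs c where
  mem_Icc f := (f.eval_mem_and_continuous D obs hc0 hc1).1
  inf_mem f f' := mem_uniformClosure_self _ (KernelFormula.min f f')
  compl_mem f := mem_uniformClosure_self _ (KernelFormula.compl f)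
  tsub_mem f q := mem_uniformClosure_self _ (KernelFormula.tsub f q)

/-- Duality turns the transport cost into integrals of formulas, which at rational t, once
discounted, are the formulas ⟨t⟩f. -/
theorem kernelFunctional_lambdaDist_le (hc0 : 0 < c) (hc1 : c < 1) (x y : E) :
    kernelFunctional D c (lambdaDist D obs c) x y ≤ lambdaDist D obs c x y := by
  have := polishSpace_of_locallyCompact E
  have hF := fun f : KernelFormula => f.eval_mem_and_continuous D obs hc0 hc1
  refine iSup_le fun t => (mul_le_mul_right
    ((isApproxLattice_kernelFormula D obs hc0 hc1).transport_le
      fun f => (hF f).2.measurable) _).trans ?_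
  rw [ENNReal.mul_iSup]
  refine iSup_le fun f => ofReal_rpow_mul_le_of_rat hc0
    (D.continuous_integral_kernel_time (hF f).2 (hF f).1 x)
    (D.continuous_integral_kernel_time (hF f).2 (hF f).1 y) (fun q => ?_) t
  exact le_iSup (fun f : KernelFormula => ENNReal.ofReal |f.eval D obs c x - f.eval D obs c y|)
    (KernelFormula.diamond q f)

theorem lambdaDist_eq_deltaBar (hc0 : 0 < c) (hc1 : c < 1) :
    lambdaDist D obs c = deltaBar D obs c := by
  ext x y
  refine le_antisymm (iSup_le fun f => ?_) (iSup_le fun n => ?_)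
  · obtain ⟨n, hn⟩ := f.exists_le_deltaSeq D obs hc0 hc1
    exact le_iSup_of_le n (hn x y)
  · induction n generalizing x y with
    | zero => exact le_iSup (fun f : KernelFormula =>
        ENNReal.ofReal |f.eval D obs c x - f.eval D obs c y|) KernelFormula.obs
    | succ n ih =>
      exact (kernelFunctional_mono D ih x y).trans (kernelFunctional_lambdaDist_le D obs hc0 hc1 x y)

end Kernel

-- The trajectory-based logic

section Trajectory

section Continuity

variable [BorelSpace E] [SecondCountableTopology E]

mutual

theorem StateFormula.eval_mem_and_continuous (hc0 : 0 < c) (hc1 : c < 1) :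
    ∀ f : StateFormula, (∀ x, f.eval D obs c x ∈ Set.Icc (0 : ℝ) 1) ∧ Continuous (f.eval D obs c)
  | .const q => ⟨fun x => by simpa only [StateFormula.eval] using ratCast_mem_Icc q,
      by simp only [StateFormula.eval]; fun_prop⟩
  | .obs => ⟨fun x => by simpa only [StateFormula.eval] using (obs x).2,
      by simp only [StateFormula.eval]; fun_prop⟩
  | .compl f => by
    have ih := f.eval_mem_and_continuous hc0 hc1
    simp only [StateFormula.eval]
    exact ⟨fun x => Set.Icc.mem_iff_one_sub_mem.1 (ih.1 x), continuous_const.sub ih.2⟩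
  | .integral g => by
    obtain ⟨h1, h2, h3⟩ := g.eval_mem_and_continuous hc0 hc1
    simp only [StateFormula.eval]
    exact ⟨fun x => (integral_mem_Icc h3 h1).2, D.continuous_integral_law h2 h1⟩

/-- Continuity on Ω serves weak continuity of the laws, while measurability refers to the coordinate
σ-algebra, so both are carried through the induction. -/
theorem TrajFormula.eval_mem_and_continuous (hc0 : 0 < c) (hc1 : c < 1) :
    ∀ g : TrajFormula, (∀ ω, g.eval D obs c ω ∈ Set.Icc (0 : ℝ) 1) ∧
      Continuous (g.eval D obs c) ∧ Measurable (g.eval D obs c)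
  | .ev f t => by
    obtain ⟨h1, h2⟩ := f.eval_mem_and_continuous hc0 hc1
    simp only [TrajFormula.eval]
    exact ⟨fun ω => mul_mem_Icc (rpow_mem_Icc hc0 hc1 (by positivity)) (h1 _),
      continuous_const.mul (h2.comp (continuous_eval_const _)),
      (h2.measurable.comp (measurable_eval E _)).const_mul _⟩
  | .min g₁ g₂ => by
    obtain ⟨h1, h2, h3⟩ := g₁.eval_mem_and_continuous hc0 hc1
    obtain ⟨h1', h2', h3'⟩ := g₂.eval_mem_and_continuous hc0 hc1
    simp only [TrajFormula.eval]
    exact ⟨fun ω => ⟨le_min (h1 ω).1 (h1' ω).1, min_le_of_left_le (h1 ω).2⟩, h2.min h2',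
      h3.min h3'⟩
  | .max g₁ g₂ => by
    obtain ⟨h1, h2, h3⟩ := g₁.eval_mem_and_continuous hc0 hc1
    obtain ⟨h1', h2', h3'⟩ := g₂.eval_mem_and_continuous hc0 hc1
    simp only [TrajFormula.eval]
    exact ⟨fun ω => ⟨le_max_of_le_left (h1 ω).1, max_le (h1 ω).2 (h1' ω).2⟩, h2.max h2',
      h3.max h3'⟩
  | .tsub g q => by
    obtain ⟨h1, h2, h3⟩ := g.eval_mem_and_continuous hc0 hc1
    simp only [TrajFormula.eval]
    exact ⟨fun ω => ⟨le_max_left _ _, max_le zero_le_one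
      (by linarith [(h1 ω).2, (ratCast_mem_Icc q).1])⟩,
      continuous_const.max (h2.sub continuous_const), measurable_const.max (h3.sub_const _)⟩
  | .tadd g q => by
    obtain ⟨h1, h2, h3⟩ := g.eval_mem_and_continuous hc0 hc1
    simp only [TrajFormula.eval]
    exact ⟨fun ω => ⟨le_min zero_le_one
      (by linarith [(h1 ω).1, (ratCast_mem_Icc q).1]), min_le_left _ _⟩,
      continuous_const.min (h2.add continuous_const), measurable_const.min (h3.add_const _)⟩

end

end Continuity

section Bounds

variable [BorelSpace E] [SecondCountableTopology E] [T2Space E]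

mutual

theorem StateFormula.exists_le_dSeq (hc0 : 0 < c) (hc1 : c < 1) :
    ∀ f : StateFormula, ∃ n, ∀ x y,
      ENNReal.ofReal |f.eval D obs c x - f.eval D obs c y| ≤ dSeq D obs c n x y
  | .const q => ⟨0, by simp [StateFormula.eval]⟩
  | .obs => ⟨0, fun x y => by simp only [StateFormula.eval]; exact le_rfl⟩
  | .compl f => by
    obtain ⟨n, hn⟩ := f.exists_le_dSeq hc0 hc1
    refine ⟨n, fun x y => ofReal_abs_mono (le_of_eq ?_) (hn x y)⟩
    simp only [StateFormula.eval]
    rw [sub_sub_sub_cancel_left, abs_sub_comm]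
  | .integral g => by
    obtain ⟨n, hn⟩ := g.exists_le_discountedUniform_dSeq hc0 hc1
    obtain ⟨h1, h2, h3⟩ := g.eval_mem_and_continuous D obs hc0 hc1
    simp only [StateFormula.eval]
    exact ⟨n + 1, fun x y => ofReal_abs_integral_sub_le_transport h3
      (integral_mem_Icc h3 h1).1 (integral_mem_Icc h3 h1).1 hn⟩

theorem TrajFormula.exists_le_discountedUniform_dSeq (hc0 : 0 < c) (hc1 : c < 1) :
    ∀ g : TrajFormula, ∃ n, ∀ ω ω', ENNReal.ofReal |g.eval D obs c ω - g.eval D obs c ω'| ≤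
      discountedUniform c (dSeq D obs c n) ω ω'
  | .ev f t => by
    obtain ⟨n, hn⟩ := f.exists_le_dSeq hc0 hc1
    refine ⟨n, fun ω ω' => ?_⟩
    simp only [TrajFormula.eval]
    rw [← ofReal_rpow_mul hc0]
    refine le_trans ?_ (le_discountedUniform _ ω ω' (t : ℝ≥0))
    simp only [coe_nnratCast_nnreal]
    exact mul_le_mul_right (hn _ _) _
  | .min g₁ g₂ => by
    obtain ⟨n, hn⟩ := g₁.exists_le_discountedUniform_dSeq hc0 hc1
    obtain ⟨k, hk⟩ := g₂.exists_le_discountedUniform_dSeq hc0 hc1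
    simp only [TrajFormula.eval]
    exact ⟨n + k, fun ω ω' => ofReal_abs_le_of_le_max (abs_min_sub_min_le_max _ _ _ _)
      ((hn ω ω').trans (discountedUniform_mono
        (fun x y => dSeq_monotone D obs x y (Nat.le_add_right n k)) ω ω'))
      ((hk ω ω').trans (discountedUniform_mono
        (fun x y => dSeq_monotone D obs x y (Nat.le_add_left k n)) ω ω'))⟩
  | .max g₁ g₂ => by
    obtain ⟨n, hn⟩ := g₁.exists_le_discountedUniform_dSeq hc0 hc1
    obtain ⟨k, hk⟩ := g₂.exists_le_discountedUniform_dSeq hc0 hc1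
    simp only [TrajFormula.eval]
    exact ⟨n + k, fun ω ω' => ofReal_abs_le_of_le_max (abs_max_sub_max_le_max _ _ _ _)
      ((hn ω ω').trans (discountedUniform_mono
        (fun x y => dSeq_monotone D obs x y (Nat.le_add_right n k)) ω ω'))
      ((hk ω ω').trans (discountedUniform_mono
        (fun x y => dSeq_monotone D obs x y (Nat.le_add_left k n)) ω ω'))⟩
  | .tsub g q => by
    obtain ⟨n, hn⟩ := g.exists_le_discountedUniform_dSeq hc0 hc1
    simp only [TrajFormula.eval]
    exact ⟨n, fun ω ω' => ofReal_abs_mono (abs_max_zero_sub_sub_le _ _ _) (hn ω ω')⟩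
  | .tadd g q => by
    obtain ⟨n, hn⟩ := g.exists_le_discountedUniform_dSeq hc0 hc1
    simp only [TrajFormula.eval]
    exact ⟨n, fun ω ω' => ofReal_abs_mono (abs_min_one_add_sub_le _ _ _) (hn ω ω')⟩

end

end Bounds

variable [BorelSpace E] [SecondCountableTopology E]

/-- The logic `𝓛_τ` is, up to arbitrarily small errors, closed under negation. -/
theorem TrajFormula.compl_mem_uniformClosure (hc0 : 0 < c) (hc1 : c < 1) :
    ∀ g : TrajFormula, (fun ω => 1 - g.eval D obs c ω) ∈
      uniformClosure fun g : TrajFormula => g.eval D obs c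
  | .ev f t => fun ε hε => by
    have hc := rpow_mem_Icc hc0 hc1 (t := (t : ℝ)) (by positivity)
    -- Negation is available on states only: 1 - c^t f = c^t (1 - f) + (1 - c^t), and the possibly
    -- irrational constant 1 - c^t is replaced by a rational q.
    obtain ⟨q, hq⟩ := exists_rat_mem_Icc_abs_sub_le (Set.Icc.mem_iff_one_sub_mem.1 hc) hε
    refine ⟨.tadd (.ev (.compl f) t) q, fun ω => ?_⟩
    have h1 := mul_mem_Icc hc ((f.eval_mem_and_continuous D obs hc0 hc1).1 (ω (t : ℝ≥0)))
    simp only [TrajFormula.eval, StateFormula.eval]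
    rw [Set.mem_Icc] at h1
    rw [abs_le] at hq ⊢
    rw [mul_sub, mul_one]
    grind
  | .min g₁ g₂ => fun ε hε => by
    obtain ⟨k₁, h₁⟩ := g₁.compl_mem_uniformClosure hc0 hc1 ε hε
    obtain ⟨k₂, h₂⟩ := g₂.compl_mem_uniformClosure hc0 hc1 ε hε
    refine ⟨.max k₁ k₂, fun ω => ?_⟩
    simp only [TrajFormula.eval]
    rw [← max_sub_sub_left]
    exact (abs_max_sub_max_le_max _ _ _ _).trans (max_le (h₁ ω) (h₂ ω))
  | .max g₁ g₂ => fun ε hε => by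
    obtain ⟨k₁, h₁⟩ := g₁.compl_mem_uniformClosure hc0 hc1 ε hε
    obtain ⟨k₂, h₂⟩ := g₂.compl_mem_uniformClosure hc0 hc1 ε hε
    refine ⟨.min k₁ k₂, fun ω => ?_⟩
    simp only [TrajFormula.eval]
    rw [← min_sub_sub_left]
    exact (abs_min_sub_min_le_max _ _ _ _).trans (max_le (h₁ ω) (h₂ ω))
  | .tsub g q => fun ε hε => by
    obtain ⟨k, h⟩ := g.compl_mem_uniformClosure hc0 hc1 ε hε
    refine ⟨.tadd k q, fun ω => ?_⟩
    simp only [TrajFormula.eval]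
    rw [← min_sub_sub_left, sub_zero, ← sub_add]
    exact (abs_min_one_add_sub_le _ _ _).trans (h ω)
  | .tadd g q => fun ε hε => by
    obtain ⟨k, h⟩ := g.compl_mem_uniformClosure hc0 hc1 ε hε
    refine ⟨.tsub k q, fun ω => ?_⟩
    simp only [TrajFormula.eval]
    rw [← max_sub_sub_left, sub_self, ← sub_sub]
    exact (abs_max_zero_sub_sub_le _ _ _).trans (h ω)

theorem isApproxLattice_trajFormula (hc0 : 0 < c) (hc1 : c < 1) :
    IsApproxLattice fun g : TrajFormula => g.eval D obs c where
  mem_Icc g := (g.eval_mem_and_continuous D obs hc0 hc1).1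
  inf_mem g g' := by
    simpa only [TrajFormula.eval] using
      mem_uniformClosure_self (fun g : TrajFormula => g.eval D obs c) (TrajFormula.min g g')
  compl_mem g := g.compl_mem_uniformClosure D obs hc0 hc1
  tsub_mem g q := by
    simpa only [TrajFormula.eval] using
      mem_uniformClosure_self (fun g : TrajFormula => g.eval D obs c) (TrajFormula.tsub g q)

theorem discountedUniform_ellDist_le (hc0 : 0 < c) (hc1 : c < 1) (ω ω' : Trajectory E) :
    discountedUniform c (ellDist D obs c) ω ω' ≤
      ⨆ g : TrajFormula, ENNReal.ofReal |g.eval D obs c ω - g.eval D obs c ω'| := by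
  refine iSup_le fun t => ?_
  rw [ellDist, ENNReal.mul_iSup]
  refine iSup_le fun f => ?_
  have hf := (f.eval_mem_and_continuous D obs hc0 hc1).2
  refine ofReal_rpow_mul_le_of_rat hc0 (hf.comp ω.continuous) (hf.comp ω'.continuous)
    (fun q => ?_) t
  have := le_iSup (fun g : TrajFormula => ENNReal.ofReal |g.eval D obs c ω - g.eval D obs c ω'|)
    (TrajFormula.ev f q)
  simp only [TrajFormula.eval] at this
  exact this

variable [LocallyCompactSpace E] [T2Space E]

/-- The cost is bounded by the suprema over 𝓛_τ, and duality on Ω leaves the integrals ∫ g, which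
are state formulas. -/
theorem trajFunctional_ellDist_le (hc0 : 0 < c) (hc1 : c < 1) (x y : E) :
    trajFunctional D c (ellDist D obs c) x y ≤ ellDist D obs c x y := by
  have := polishSpace_of_locallyCompact E
  have := standardBorelSpace_trajectory E
  refine (transport_mono (discountedUniform_ellDist_le D obs hc0 hc1) _ _).trans
    (((isApproxLattice_trajFormula D obs hc0 hc1).transport_le
      fun g => (g.eval_mem_and_continuous D obs hc0 hc1).2.2).trans (iSup_le fun g => ?_))
  have := le_iSup (fun f : StateFormula => ENNReal.ofReal |f.eval D obs c x - f.eval D obs c y|)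
    (StateFormula.integral g)
  simp only [StateFormula.eval] at this
  exact this

theorem dBar_eq_ellDist (hc0 : 0 < c) (hc1 : c < 1) : dBar D obs c = ellDist D obs c := by
  ext x y
  refine le_antisymm (iSup_le fun n => ?_) (iSup_le fun f => ?_)
  · induction n generalizing x y with
    | zero =>
      have := le_iSup (fun f : StateFormula =>
        ENNReal.ofReal |f.eval D obs c x - f.eval D obs c y|) StateFormula.obs
      simp only [StateFormula.eval] at this
      exact this
    | succ n ih =>
      exact (trajFunctional_mono D ih x y).trans (trajFunctional_ellDist_le D obs hc0 hc1 x y)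
  · obtain ⟨n, hn⟩ := f.exists_le_dSeq D obs hc0 hc1
    exact le_iSup_of_le n (hn x y)

end Trajectory

end FellerDynkin

open FellerDynkin
theorem mainTheorem5 {E : Type*} [TopologicalSpace E] [LocallyCompactSpace E] [T2Space E]
    [SecondCountableTopology E] [MeasurableSpace E] [BorelSpace E]
    (D : Diffusion E) (obs : C(E, unitInterval)) (c : ℝ) (hc0 : 0 < c) (hc1 : c < 1) :
    lambdaDist D obs c = deltaBar D obs c ∧
      deltaBar D obs c ≤ dBar D obs c ∧
      dBar D obs c = ellDist D obs c :=
  ⟨lambdaDist_eq_deltaBar D obs hc0 hc1,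
    fun x y => iSup_mono fun n => deltaSeq_le_dSeq D obs n x y,
    dBar_eq_ellDist D obs hc0 hc1⟩
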